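/- **Setting.** Let $n,q,s$ be natural numbers, $M_1,\dots,M_s$ real $n\times n$ matrices, $\phi>0$, and $h,v:\mathbb R\to\mathbb R$ Borel measurable (inverse link and variance function). For one subject with response $Y\in\mathbb R^n$ and covariates $X=(X_1,\dots,X_n)$, $X_t\in\mathbb R^q$, let $\mathbf h(\beta)=(h(X_t^T\beta))_{t\le n}$, let $\nabla\mathbf h(\beta)$ be its $n\times q$ matrix of partial derivatives in $\beta$, let $A(\beta)=\mathrm{diag}(\phi\,v(X_t^T\beta))_{t\le n}$, and let the score $g(\beta)\in\mathbb R^{sq}$ consist of the blocks $$\nabla\mathbf h(\beta)^T A(\beta)^{-1/2}M_jA(\beta)^{-1/2}\,(Y-\mathbf h(\beta)),\qquad j=1,\dots,s .$$ Let $(Y_i,X_i)$, $i=1,2,\dots$, be independent with common distribution $F$, let $g_i$ be the score of subject $i$, and put $$\bar g_N=\frac1N\sum_{i=1}^N g_i,\qquad \hat C_N=\frac1N\sum_{i=1}^N g_ig_i^T,\qquad Q_N(\beta)=N\,\bar g_N(\beta)^T\hat C_N(\beta)^{-1}\bar g_N(\beta),$$ with $Q_N(\beta)=0$ where $\hat C_N(\beta)$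 is singular. Gradients and Hessians of $Q_N$ are formed from its partial derivatives, which are set to $0$ at points where the function differentiated is not differentiable. Let $\mathcal B\subseteq\mathbb R^q$ be the parameter set and $\beta_0\in\mathcal B$ the true parameter: $Y_{1t}$ is integrable and $E(Y_{1t}\mid X_1)=h(X_{1t}^T\beta_0)$ almost surely, for every $t$. Assume the following. 1. Almost surely, for all $\beta$ in some neighbourhood of $\mathcal B$ (which may depend on the data) and all $t$, $h$ is differentiable at $X_{1t}^T\beta$ and $v(X_{1t}^T\beta)>0$. Almost surely, every point of $\mathcal B$ has a neighbourhood on which $g_1$ is twice continuously differentiable. 2. The entries of $g_1(\beta)$ and of $g_1(\beta)g_1(\beta)^T$ and their first- and second-order partial derivatives in $\beta$ have finite means, locally uniformly: for each compact $K\subseteq\mathcal B$ and each such entry there is an integrable function of $(Y_1,X_1)$ that almost surely bounds the absolute values of the entry and of these derivatives for all $\beta\in K$. 3. $\Sigma(\beta)=E\{g_1(\beta)g_1(\beta)^T\}$ is positive definite for every $\beta\in\mathcal B$. Let $D(\beta)=E\{\nabla g_1(\beta)\}$ (an $sq\times q$ matrix) and $J(\beta_0)=D(\beta_0)^T\Sigma(\beta_0)^{-1}D(\beta_0)$.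 **Theorem 3.1.** As $N\to\infty$, $$\frac1{2\sqrt N}\nabla Q_N(\beta_0)\xrightarrow{d}N_q\{0,J(\beta_0)\}.$$ Moreover there is a nonrandom $q\times q$ matrix function $V(\beta)$, continuous on $\mathcal B$, with $V(\beta_0)=J(\beta_0)$, such that $$\frac1{2N}\nabla^2Q_N(\beta)=V(\beta)+o_p(1)$$ uniformly on compact sets: for every compact $K\subseteq\mathcal B$ and $\varepsilon>0$, the (outer) probability that some entry of $\frac1{2N}\nabla^2Q_N(\beta)-V(\beta)$ is at least $\varepsilon$ in absolute value for some $\beta\in K$ tends to $0$. -/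

import Mathlib

open MeasureTheory ProbabilityTheory Filter Topology
open scoped Matrix

namespace QIF

/-- The data of one subject: the response vector `Y ∈ ℝⁿ` and the covariate vectors
`X_1, …, X_n ∈ ℝ^q` at the `n` observation times. -/
abbrev Obs (n q : ℕ) : Type :=
  (Fin n → ℝ) × (Fin n → EuclideanSpace ℝ (Fin q))

/-- The partial derivative `∂f/∂β_k` at `β`. -/
noncomputable def pderiv {q : ℕ} (k : Fin q) (f : EuclideanSpace ℝ (Fin q) → ℝ)
    (β : EuclideanSpace ℝ (Fin q)) : ℝ :=
  fderiv ℝ f β (EuclideanSpace.single k 1)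

/-- The vector `∇f(β)` of partial derivatives. -/
noncomputable def grad {q : ℕ} (f : EuclideanSpace ℝ (Fin q) → ℝ)
    (β : EuclideanSpace ℝ (Fin q)) : EuclideanSpace ℝ (Fin q) :=
  WithLp.toLp 2 fun k => pderiv k f β

/-- The matrix `∇²f(β)` of second-order partial derivatives. -/
noncomputable def hess {q : ℕ} (f : EuclideanSpace ℝ (Fin q) → ℝ)
    (β : EuclideanSpace ℝ (Fin q)) : Matrix (Fin q) (Fin q) ℝ :=
  Matrix.of fun j k => pderiv j (pderiv k f) β

/-- A generalized linear model with extended scores: basis matrices `M_1, …, M_s`, dispersion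
parameter `φ`, inverse link `h` and variance function `v`. -/
structure Model (n s : ℕ) where
  M : Fin s → Matrix (Fin n) (Fin n) ℝ
  φ : ℝ
  h : ℝ → ℝ
  v : ℝ → ℝ

section Score

variable {n q s : ℕ} (m : Model n s)

/-- The mean vector with entries `h(X_tᵀ β)`. -/
noncomputable def meanVec (x : Fin n → EuclideanSpace ℝ (Fin q))
    (β : EuclideanSpace ℝ (Fin q)) : Fin n → ℝ :=
  fun t => m.h (inner ℝ (x t) β)

/-- The `n × q` matrix of the partial derivatives of the mean vector with respect to `β`. -/
noncomputable def gradMean (x : Fin n → EuclideanSpace ℝ (Fin q))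
    (β : EuclideanSpace ℝ (Fin q)) : Matrix (Fin n) (Fin q) ℝ :=
  Matrix.of fun t k => pderiv k (fun b => meanVec m x b t) β

/-- `A^{-1/2}`, where `A` is the diagonal matrix with entries `φ v(X_tᵀ β)`. -/
noncomputable def invSqrtVar (x : Fin n → EuclideanSpace ℝ (Fin q))
    (β : EuclideanSpace ℝ (Fin q)) : Matrix (Fin n) (Fin n) ℝ :=
  Matrix.diagonal fun t => (√(m.φ * m.v (inner ℝ (x t) β)))⁻¹

/-- The subject-specific score `g(β) ∈ ℝ^{sq}`, whose `j`-th block is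
`∇hᵀ A^{-1/2} M_j A^{-1/2} (Y - h)`. -/
noncomputable def score (z : Obs n q) (β : EuclideanSpace ℝ (Fin q)) : Fin s × Fin q → ℝ :=
  fun a =>
    (((gradMean m z.2 β)ᵀ * invSqrtVar m z.2 β * m.M a.1 * invSqrtVar m z.2 β) *ᵥ
      (z.1 - meanVec m z.2 β)) a.2

/-- The extended score `(1/N) ∑_{i<N} g_i(β)` of the data `z_0, …, z_{N-1}`. -/
noncomputable def scoreMean (N : ℕ) (z : ℕ → Obs n q) (β : EuclideanSpace ℝ (Fin q)) :
    Fin s × Fin q → ℝ :=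
  (N : ℝ)⁻¹ • ∑ i ∈ Finset.range N, score m (z i) β

/-- The second moment estimator `(1/N) ∑_{i<N} g_i(β) g_i(β)ᵀ`. -/
noncomputable def secondMomentHat (N : ℕ) (z : ℕ → Obs n q) (β : EuclideanSpace ℝ (Fin q)) :
    Matrix (Fin s × Fin q) (Fin s × Fin q) ℝ :=
  (N : ℝ)⁻¹ • ∑ i ∈ Finset.range N, Matrix.vecMulVec (score m (z i) β) (score m (z i) β)

/-- The quadratic inference function `Q_N(β) = N ḡᵀ Ĉ⁻¹ ḡ`. Where `Ĉ` is singular, Mathlib's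
inverse is `0` and `Q_N(β) = 0`. -/
noncomputable def qif (N : ℕ) (z : ℕ → Obs n q) (β : EuclideanSpace ℝ (Fin q)) : ℝ :=
  (N : ℝ) * (scoreMean m N z β ⬝ᵥ ((secondMomentHat m N z β)⁻¹ *ᵥ scoreMean m N z β))

/-- The second moment matrix `E{g(β) g(β)ᵀ}` under the distribution `F` of one subject. -/
noncomputable def secondMoment (F : Measure (Obs n q)) (β : EuclideanSpace ℝ (Fin q)) :
    Matrix (Fin s × Fin q) (Fin s × Fin q) ℝ :=
  Matrix.of fun a b => ∫ z, score m z β a * score m z β b ∂F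

/-- The `sq × q` matrix `D(β) = E{∇g(β)}`. -/
noncomputable def scoreDeriv (F : Measure (Obs n q)) (β : EuclideanSpace ℝ (Fin q)) :
    Matrix (Fin s × Fin q) (Fin q) ℝ :=
  Matrix.of fun a k => ∫ z, pderiv k (fun b => score m z b a) β ∂F

/-- The information matrix `J(β) = D(β)ᵀ Σ(β)⁻¹ D(β)`. -/
noncomputable def infoMatrix (F : Measure (Obs n q)) (β : EuclideanSpace ℝ (Fin q)) :
    Matrix (Fin q) (Fin q) ℝ :=
  (scoreDeriv m F β)ᵀ * (secondMoment m F β)⁻¹ * scoreDeriv m F β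

end Score

/-- The random function `f` and its partial derivatives of orders one and two have finite means,
uniformly in the parameter: on each compact subset of `B` they are dominated by one integrable
function of the data. -/
def DominatedUpToOrderTwo {n q : ℕ} (F : Measure (Obs n q)) (B : Set (EuclideanSpace ℝ (Fin q)))
    (f : Obs n q → EuclideanSpace ℝ (Fin q) → ℝ) : Prop :=
  ∀ K ⊆ B, IsCompact K → ∃ env : Obs n q → ℝ, Integrable env F ∧
    ∀ᵐ z ∂F, ∀ β ∈ K,
      |f z β| ≤ env z ∧
      (∀ k, |pderiv k (f z) β| ≤ env z) ∧
      ∀ j k, |pderiv j (pderiv k (f z)) β| ≤ env z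

end QIF

/-! Divided by `N`, the quadratic inference function is `uᵀ A⁻¹ u`, where the vector `u` and the
matrix `A` are sample means. Its gradient and Hessian are explicit functions of the jets of `u` and
`A` (values, first and second partial derivatives), continuous wherever `A` is invertible. The jets
are again sample means, so both claims reduce to limit theorems for independent identically
distributed terms.

Put `w = A⁻¹ u` and let subscripts denote partial derivatives. Half the `k`-th derivative of `uᵀ A⁻¹
u` is `uᵀ A⁻¹ (u_k - ½ A_k w)`, a coefficient `halfGradCoeff` paired with `u` (`pderiv_quadInv`). At
`β₀` the score is centred given the covariates (`integral_score_eq_zero`), so `√N u` tends to `N(0,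
Σ)`, while `w → 0` and the coefficients tend to `Dᵀ Σ⁻¹`. Slutsky's theorem gives the limit `Dᵀ Σ⁻¹
N(0, Σ) = N(0, J)`.

For the Hessian, the strong law in the Banach space of continuous functions on `K`
(`uniform_law_of_large_numbers`) makes the jets converge uniformly on `K` to their means
`momentJets`. These means form a compact set of jets with invertible matrix part, near which
`halfHess` is uniformly controlled (`exists_forall_dist_lt_halfHess`). So `V` is `halfHess` of the
mean jets; at `β₀` the mean of `u` vanishes and only `D_kᵀ Σ⁻¹ D_j` survives. Means of derivatives
occur throughout, so expectation and differentiation are never interchanged. -/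

/-! ### Measurability of random continuous functions. -/

namespace ContinuousMap

variable {X E : Type*} [TopologicalSpace X] [CompactSpace X] [T2Space X]
  [SecondCountableTopology X]
  [MetricSpace E] [SecondCountableTopology E] [CompleteSpace E]
  [MeasurableSpace E] [BorelSpace E]

/-- A random continuous function on a compact second countable space is measurable as soon as its
evaluations are. -/
theorem aemeasurable_of_eval [MeasurableSpace C(X, E)] [BorelSpace C(X, E)]
    {Z : Type*} [MeasurableSpace Z] {μ : Measure Z} {G : Z → C(X, E)}
    (hG : ∀ x, AEMeasurable (fun z => G z x) μ) : AEMeasurable G μ := by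
  obtain ⟨D, hDc, hDd⟩ := TopologicalSpace.exists_countable_dense X
  have : Countable D := hDc.to_subtype
  let r : C(X, E) → (D → E) := fun f d => f d
  have hr : Continuous r := continuous_pi fun d => continuous_eval_const (d : X)
  have hinj : Function.Injective r := fun f g hfg =>
    DFunLike.coe_injective (f.continuous.ext_on hDd g.continuous fun x hx => congrFun hfg ⟨x, hx⟩)
  -- Lusin–Souslin: restriction to a countable dense set is a continuous injection of the Polish
  -- space `C(X, E)`, hence a measurable embedding.
  exact (hr.measurableEmbedding hinj).aemeasurable_comp_iff.1
    (aemeasurable_pi_iff.2 fun d => hG d)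

end ContinuousMap

/-! ### Limit theorems for independent identically distributed data. -/

namespace ProbabilityTheory

variable {Ω 𝓩 : Type*} {mΩ : MeasurableSpace Ω} {m𝓩 : MeasurableSpace 𝓩}
  {P : Measure Ω} {F : Measure 𝓩} {Z : ℕ → Ω → 𝓩}

theorem identDistrib_comp_of_hasLaw {V : Type*} [MeasurableSpace V] (hlaw : ∀ i, HasLaw (Z i) F P)
    {G : 𝓩 → V} (hG : AEMeasurable G F) (i j : ℕ) :
    IdentDistrib (fun ω => G (Z i ω)) (fun ω => G (Z j ω)) P P := by
  have h : ∀ i, AEMeasurable (fun ω => G (Z i ω)) P := fun i =>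
    AEMeasurable.comp_aemeasurable (by rwa [(hlaw i).map_eq]) (hlaw i).aemeasurable
  refine ⟨h i, h j, ?_⟩
  have h' : ∀ i, P.map (fun ω => G (Z i ω)) = F.map G := fun i => by
    have := AEMeasurable.map_map_of_aemeasurable (g := G) (f := Z i) (μ := P)
      (by rwa [(hlaw i).map_eq]) (hlaw i).aemeasurable
    rw [(hlaw i).map_eq] at this
    exact this.symm
  rw [h', h']

theorem ae_forall_of_hasLaw (hlaw : ∀ i, HasLaw (Z i) F P) {p : 𝓩 → Prop} (hp : ∀ᵐ z ∂F, p z) :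
    ∀ᵐ ω ∂P, ∀ i, p (Z i ω) := by
  refine ae_all_iff.2 fun i => ae_of_ae_map (hlaw i).aemeasurable ?_
  rwa [(hlaw i).map_eq]

theorem iIndepFun_comp_of_hasLaw {V : Type*} [MeasurableSpace V] (hlaw : ∀ i, HasLaw (Z i) F P)
    (hindep : iIndepFun Z P) {G : 𝓩 → V} (hG : AEMeasurable G F) :
    iIndepFun (fun i ω => G (Z i ω)) P := by
  have h := hindep.comp (fun _ => hG.mk G) fun _ => hG.measurable_mk
  refine h.congr fun i => ?_
  have := ae_forall_of_hasLaw hlaw hG.ae_eq_mk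
  filter_upwards [this] with ω hω
  exact (hω i).symm

/-- **Uniform law of large numbers**: the empirical means of a dominated random continuous function
on a compact set converge uniformly, with a measurable bound for the error. -/
theorem uniform_law_of_large_numbers {E V : Type*} [MetricSpace E]
    [SecondCountableTopology E]
    [NormedAddCommGroup V] [NormedSpace ℝ V] [CompleteSpace V] [SecondCountableTopology V]
    [MeasurableSpace V] [BorelSpace V]
    (hlaw : ∀ i, HasLaw (Z i) F P) (hindep : iIndepFun Z P)
    {K : Set E} (hK : IsCompact K) {T : 𝓩 → E → V}
    (hmeas : ∀ x ∈ K, AEMeasurable (fun z => T z x) F)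
    (hcont : ∀ᵐ z ∂F, ContinuousOn (T z) K)
    {env : 𝓩 → ℝ} (henv : Integrable env F) (hle : ∀ᵐ z ∂F, ∀ x ∈ K, ‖T z x‖ ≤ env z) :
    ContinuousOn (fun x => ∫ z, T z x ∂F) K ∧
      ∃ D : ℕ → Ω → ℝ, (∀ N, AEMeasurable (D N) P) ∧
        (∀ᵐ ω ∂P, Tendsto (fun N => D N ω) atTop (𝓝 0)) ∧
        ∀ᵐ ω ∂P, ∀ N : ℕ, ∀ x ∈ K,
          dist ((N : ℝ)⁻¹ • ∑ i ∈ Finset.range N, T (Z i ω) x) (∫ z, T z x ∂F) ≤ D N ω := by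
  classical
  have : CompactSpace K := isCompact_iff_compactSpace.1 hK
  let _ : MeasurableSpace C(K, V) := borel _
  have : BorelSpace C(K, V) := ⟨rfl⟩
  -- The random function becomes a random element of a separable Banach space whose norm is uniform
  -- on `K`. The value `0` is used only on a null set.
  let G : 𝓩 → C(K, V) := fun z =>
    if h : ContinuousOn (T z) K then ⟨K.domRestrict (T z), h.domRestrict⟩ else 0
  have hGeq : ∀ᵐ z ∂F, ∀ x : K, G z x = T z x := by
    filter_upwards [hcont] with z hz x
    simp only [G, hz, dite_true]
    rfl
  have hGm : AEMeasurable G F := ContinuousMap.aemeasurable_of_eval fun x =>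
    (hmeas x x.2).congr (by filter_upwards [hGeq] with z hz using (hz x).symm)
  have hGint : Integrable G F := by
    refine henv.norm.mono hGm.aestronglyMeasurable ?_
    filter_upwards [hGeq, hle] with z hz hz'
    rw [norm_norm, ContinuousMap.norm_le _ (norm_nonneg _)]
    intro x
    rw [hz x]
    exact (hz' x x.2).trans (le_abs_self _)
  have hmean : ∀ x : K, (∫ z, G z ∂F) x = ∫ z, T z x ∂F := fun x => by
    have := (ContinuousMap.evalCLM ℝ x : C(K, V) →L[ℝ] V).integral_comp_comm hGint
    refine this.symm.trans (integral_congr_ae ?_)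
    filter_upwards [hGeq] with z hz using hz x
  have hident := identDistrib_comp_of_hasLaw (P := P) hlaw hGm
  have hint0 : Integrable (fun ω => G (Z 0 ω)) P := by
    have h := hlaw 0
    rw [← h.map_eq] at hGint
    exact hGint.comp_aemeasurable h.aemeasurable
  have hslln := strong_law_ae (fun i ω => G (Z i ω)) hint0
    (fun i j hij => (iIndepFun_comp_of_hasLaw hlaw hindep hGm).indepFun hij)
    (fun i => hident i 0)
  have hmean0 : ∫ ω, G (Z 0 ω) ∂P = ∫ z, G z ∂F := (hlaw 0).integral_comp hGm.aestronglyMeasurable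
  rw [hmean0] at hslln
  -- The error bound is the sup-norm distance to the Bochner mean, and that mean, being an element
  -- of `C(K, V)`, is continuous at once.
  refine ⟨?_, fun N ω => dist ((N : ℝ)⁻¹ • ∑ i ∈ Finset.range N, G (Z i ω)) (∫ z, G z ∂F), ?_,
    ?_, ?_⟩
  · rw [continuousOn_iff_continuous_domRestrict]
    convert (∫ z, G z ∂F).continuous using 1
    ext x
    exact (hmean x).symm
  · intro N
    have h := Finset.aemeasurable_fun_sum (Finset.range N) fun i _ => (hident i i).aemeasurable_fst
    exact (measurable_dist.comp_aemeasurable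
      (((measurable_const_smul ((N : ℝ)⁻¹)).comp_aemeasurable h).prodMk aemeasurable_const))
  · filter_upwards [hslln] with ω hω
    exact tendsto_iff_dist_tendsto_zero.1 hω
  · filter_upwards [ae_forall_of_hasLaw hlaw hGeq] with ω hω N x hx
    have h := ContinuousMap.dist_apply_le_dist (f := (N : ℝ)⁻¹ • ∑ i ∈ Finset.range N, G (Z i ω))
      (g := ∫ z, G z ∂F) (⟨x, hx⟩ : K)
    rw [hmean] at h
    simpa [ContinuousMap.sum_apply, hω] using h

/-- **Multivariate central limit theorem** for centred square integrable vectors. -/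
theorem tendstoInDistribution_inv_sqrt_smul_sum [IsProbabilityMeasure P] {ι : Type*} [Fintype ι]
    [DecidableEq ι]
    (hlaw : ∀ i, HasLaw (Z i) F P) (hindep : iIndepFun Z P)
    {f : 𝓩 → EuclideanSpace ℝ ι} (hf : ∀ a, MemLp (fun z => f z a) 2 F)
    (hzero : ∀ a, ∫ z, f z a ∂F = 0) :
    TendstoInDistribution (fun (N : ℕ) ω => (√(N : ℝ))⁻¹ • ∑ i ∈ Finset.range N, f (Z i ω))
      atTop id (fun _ => P)
      (multivariateGaussian 0 (Matrix.of fun a b => ∫ z, f z a * f z b ∂F)) := by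
  set S : Matrix ι ι ℝ := Matrix.of fun a b => ∫ z, f z a * f z b ∂F with hS
  have hfm : AEMeasurable f F := by
    have : AEMeasurable (fun z => WithLp.toLp 2 (fun a => f z a)) F :=
      (by fun_prop : Measurable (WithLp.toLp 2 : (ι → ℝ) → EuclideanSpace ℝ ι)).comp_aemeasurable
        (aemeasurable_pi_iff.2 fun a => (hf a).aestronglyMeasurable.aemeasurable)
    exact this
  have hprod : ∀ a b, Integrable (fun z => f z a * f z b) F := fun a b =>
    (hf a).integrable_mul (hf b)
  have hF : IsProbabilityMeasure F := (hlaw 0).isProbabilityMeasure_iff.1 inferInstance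
  have hlin : ∀ t : EuclideanSpace ℝ ι, MemLp (fun z => inner ℝ (f z) t) 2 F := fun t => by
    simp only [PiLp.inner_apply, RCLike.inner_apply, conj_trivial]
    exact memLp_finsetSum _ fun a _ => (hf a).const_mul (t a)
  have hquad : ∀ t : EuclideanSpace ℝ ι, ∫ z, (inner ℝ (f z) t) ^ 2 ∂F = t ⬝ᵥ S *ᵥ t := fun t => by
    have : ∀ z, (inner ℝ (f z) t) ^ 2 = ∑ a, ∑ b, t a * t b * (f z a * f z b) := fun z => by
      simp only [PiLp.inner_apply, RCLike.inner_apply, conj_trivial, sq, Finset.sum_mul_sum]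
      exact Finset.sum_congr rfl fun a _ => Finset.sum_congr rfl fun b _ => by ring
    simp_rw [this]
    rw [integral_finsetSum _ fun a _ => integrable_finsetSum _ fun b _ => (hprod a b).const_mul _]
    simp only [dotProduct, Matrix.mulVec, hS, Matrix.of_apply, Finset.mul_sum]
    refine Finset.sum_congr rfl fun a _ => ?_
    rw [integral_finsetSum _ fun b _ => (hprod a b).const_mul _]
    refine Finset.sum_congr rfl fun b _ => ?_
    rw [integral_const_mul]
    ring
  have hmean : ∀ t : EuclideanSpace ℝ ι, ∫ z, inner ℝ (f z) t ∂F = 0 := fun t => by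
    simp only [PiLp.inner_apply, RCLike.inner_apply, conj_trivial]
    rw [integral_finsetSum _ fun a _ => ((hf a).integrable one_le_two).const_mul _]
    simp [integral_const_mul, hzero]
  have hpsd : S.PosSemidef := by
    refine Matrix.PosSemidef.of_dotProduct_mulVec_nonneg ?_ fun x => ?_
    · ext a b
      simp [hS, mul_comm]
    · have := hquad (WithLp.toLp 2 x)
      simp only [star_trivial]
      rw [← this]
      exact integral_nonneg fun z => sq_nonneg _
  have hident := identDistrib_comp_of_hasLaw (P := P) hlaw hfm
  have hSm : ∀ N : ℕ, AEMeasurable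
      (fun ω => (√(N : ℝ))⁻¹ • ∑ i ∈ Finset.range N, f (Z i ω)) P := fun N =>
    (measurable_const_smul _).comp_aemeasurable
      (Finset.aemeasurable_fun_sum _ fun i _ => (hident i i).aemeasurable_fst)
  refine ⟨hSm, aemeasurable_id, ?_⟩
  refine ProbabilityMeasure.tendsto_iff_tendsto_charFun.2 fun t => ?_
  have hlm : AEMeasurable (fun z => inner ℝ (f z) t) F := (hlin t).aestronglyMeasurable.aemeasurable
  have hm0 : ∫ ω, inner ℝ (f (Z 0 ω)) t ∂P = 0 :=
    ((hlaw 0).integral_comp hlm.aestronglyMeasurable).trans (hmean t)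
  have hlint : MemLp (fun ω => inner ℝ (f (Z 0 ω)) t) 2 P := by
    have h := hlin t
    rw [← (hlaw 0).map_eq] at h
    exact h.comp_of_map (hlaw 0).aemeasurable
  have hvar : Var[fun ω => inner ℝ (f (Z 0 ω)) t; P] = t ⬝ᵥ S *ᵥ t := by
    rw [variance_of_integral_eq_zero hlint.aestronglyMeasurable.aemeasurable hm0, ← hquad]
    exact (hlaw 0).integral_comp (hlm.pow_const 2).aestronglyMeasurable
  -- Cramér–Wold: the characteristic function of the vector sum at `t` is that of its scalar
  -- projection along `t` at `1`, so the one-dimensional theorem suffices.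
  have hclt := tendstoInDistribution_inv_sqrt_mul_sum_sub
    (X := fun i ω => inner ℝ (f (Z i ω)) t) (P := P)
    (P' := gaussianReal 0 Var[fun ω => inner ℝ (f (Z 0 ω)) t; P].toNNReal) (Y := id) HasLaw.id
    hlint (iIndepFun_comp_of_hasLaw hlaw hindep hlm)
    (fun i => identDistrib_comp_of_hasLaw hlaw hlm i 0)
  have hchar := ProbabilityMeasure.tendsto_iff_tendsto_charFun.1 hclt.tendsto 1
  simp only [ProbabilityMeasure.coe_mk, Measure.map_id] at hchar ⊢
  rw [charFun_multivariateGaussian hpsd]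
  rw [charFun_gaussianReal, hvar] at hchar
  have hnn : 0 ≤ t ⬝ᵥ S *ᵥ t := by simpa using hpsd.dotProduct_mulVec_nonneg t.ofLp
  convert hchar using 2 with N
  · rw [charFun_apply, charFun_apply, integral_map (hSm N) (by fun_prop),
      integral_map (hclt.forall_aemeasurable N) (by fun_prop)]
    refine integral_congr_ae (ae_of_all _ fun ω => ?_)
    simp [hm0, inner_smul_left, sum_inner]
  · simp [Real.coe_toNNReal _ hnn]

end ProbabilityTheory

namespace QIF

/-! ### Rules for partial derivatives. -/

section PartialDerivatives

variable {q : ℕ} {k : Fin q} {β : EuclideanSpace ℝ (Fin q)} {f g : EuclideanSpace ℝ (Fin q) → ℝ}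

theorem pderiv_sub (hf : DifferentiableAt ℝ f β) (hg : DifferentiableAt ℝ g β) :
    pderiv k (fun x => f x - g x) β = pderiv k f β - pderiv k g β := by
  simp only [pderiv]
  rw [fderiv_fun_sub hf hg]
  rfl

theorem pderiv_mul (hf : DifferentiableAt ℝ f β) (hg : DifferentiableAt ℝ g β) :
    pderiv k (fun x => f x * g x) β = pderiv k f β * g β + f β * pderiv k g β := by
  simp only [pderiv]
  rw [fderiv_fun_mul hf hg]
  simp only [add_apply, smul_apply, smul_eq_mul]
  ring

theorem pderiv_const_mul (c : ℝ) (f : EuclideanSpace ℝ (Fin q) → ℝ) :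
    pderiv k (fun x => c * f x) β = c * pderiv k f β := by
  have : (fun x => c * f x) = c • f := rfl
  simp only [pderiv]
  rw [this, fderiv_const_smul_field]
  rfl

theorem pderiv_sum {ι : Type*} (t : Finset ι) {f : ι → EuclideanSpace ℝ (Fin q) → ℝ}
    (hf : ∀ i ∈ t, DifferentiableAt ℝ (f i) β) :
    pderiv k (fun x => ∑ i ∈ t, f i x) β = ∑ i ∈ t, pderiv k (f i) β := by
  simp only [pderiv]
  rw [fderiv_fun_sum hf]
  simp

theorem pderiv_congr (h : f =ᶠ[𝓝 β] g) : pderiv k f β = pderiv k g β := by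
  simp only [pderiv, h.fderiv_eq]

theorem contDiffAt_pderiv {n m : WithTop ℕ∞} (hf : ContDiffAt ℝ n f β) (hmn : m + 1 ≤ n) :
    ContDiffAt ℝ m (pderiv k f) β :=
  (hf.fderiv_right hmn).clm_apply contDiffAt_const

theorem differentiableAt_pderiv (hf : ContDiffAt ℝ 2 f β) : DifferentiableAt ℝ (pderiv k f) β :=
  (contDiffAt_pderiv (m := 1) hf (by norm_num)).differentiableAt one_ne_zero

theorem eventually_differentiableAt (hf : ContDiffAt ℝ 2 f β) :
    ∀ᶠ x in 𝓝 β, DifferentiableAt ℝ f x := by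
  filter_upwards [hf.eventually (by simp)] with x hx using hx.differentiableAt two_ne_zero

end PartialDerivatives

/-! ### First and second derivatives of `uᵀ A⁻¹ u`. -/

section MatrixCalculus

variable {q : ℕ} {I : Type*} [Fintype I] {β : EuclideanSpace ℝ (Fin q)}

/-- The vector of partial derivatives of the entries of a vector valued function. -/
noncomputable def vecPderiv (k : Fin q) (u : EuclideanSpace ℝ (Fin q) → I → ℝ)
    (β : EuclideanSpace ℝ (Fin q)) : I → ℝ :=
  fun a => pderiv k (fun x => u x a) β

/-- The matrix of partial derivatives of the entries of a matrix valued function. -/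
noncomputable def matPderiv (k : Fin q) (A : EuclideanSpace ℝ (Fin q) → Matrix I I ℝ)
    (β : EuclideanSpace ℝ (Fin q)) : Matrix I I ℝ :=
  Matrix.of fun a b => pderiv k (fun x => A x a b) β

variable {u v : EuclideanSpace ℝ (Fin q) → I → ℝ} {A : EuclideanSpace ℝ (Fin q) → Matrix I I ℝ}
  {k : Fin q}

theorem pderiv_dotProduct (hu : ∀ a, DifferentiableAt ℝ (fun x => u x a) β)
    (hv : ∀ a, DifferentiableAt ℝ (fun x => v x a) β) :
    pderiv k (fun x => u x ⬝ᵥ v x) β = vecPderiv k u β ⬝ᵥ v β + u β ⬝ᵥ vecPderiv k v β := by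
  simp only [dotProduct, vecPderiv]
  rw [pderiv_sum _ fun a _ => (hu a).fun_mul (hv a), ← Finset.sum_add_distrib]
  exact Finset.sum_congr rfl fun a _ => pderiv_mul (hu a) (hv a)

theorem differentiableAt_dotProduct (hu : ∀ a, DifferentiableAt ℝ (fun x => u x a) β)
    (hv : ∀ a, DifferentiableAt ℝ (fun x => v x a) β) :
    DifferentiableAt ℝ (fun x => u x ⬝ᵥ v x) β :=
  DifferentiableAt.fun_sum fun a _ => (hu a).fun_mul (hv a)

theorem vecPderiv_mulVec (hA : ∀ a b, DifferentiableAt ℝ (fun x => A x a b) β)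
    (hv : ∀ a, DifferentiableAt ℝ (fun x => v x a) β) :
    vecPderiv k (fun x => A x *ᵥ v x) β = matPderiv k A β *ᵥ v β + A β *ᵥ vecPderiv k v β := by
  ext a
  exact pderiv_dotProduct (u := fun x b => A x a b) (hA a) hv

theorem differentiableAt_mulVec (hA : ∀ a b, DifferentiableAt ℝ (fun x => A x a b) β)
    (hv : ∀ a, DifferentiableAt ℝ (fun x => v x a) β) (a : I) :
    DifferentiableAt ℝ (fun x => (A x *ᵥ v x) a) β :=
  differentiableAt_dotProduct (u := fun x b => A x a b) (hA a) hv

variable [DecidableEq I]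

theorem differentiableAt_det (hA : ∀ a b, DifferentiableAt ℝ (fun x => A x a b) β) :
    DifferentiableAt ℝ (fun x => (A x).det) β := by
  simp only [Matrix.det_apply]
  exact DifferentiableAt.fun_sum fun σ _ =>
    (HasFDerivAt.finsetProd fun a _ => (hA (σ a) a).hasFDerivAt).differentiableAt.const_smul _

/-- Cramer's rule: each entry of the inverse is a quotient of two determinants. -/
theorem differentiableAt_inv_apply (hA : ∀ a b, DifferentiableAt ℝ (fun x => A x a b) β)
    (hdet : (A β).det ≠ 0) (a b : I) : DifferentiableAt ℝ (fun x => (A x)⁻¹ a b) β := by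
  simp only [Matrix.inv_def, Matrix.smul_apply, smul_eq_mul, Ring.inverse_eq_inv',
    Matrix.adjugate_apply]
  refine ((differentiableAt_det hA).inv hdet).mul (differentiableAt_det fun c d => ?_)
  by_cases h : c = b
  · subst h
    simp
  · simpa [Matrix.updateRow_ne h] using hA c d

/-- The quadratic form `uᵀ A⁻¹ u` of a family of vectors and matrices. -/
noncomputable def quadInv (u : EuclideanSpace ℝ (Fin q) → I → ℝ)
    (A : EuclideanSpace ℝ (Fin q) → Matrix I I ℝ) (x : EuclideanSpace ℝ (Fin q)) : ℝ :=
  u x ⬝ᵥ ((A x)⁻¹ *ᵥ u x)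

/-- With `w = A⁻¹ u`, differentiate the identity `A w = u`, valid near `β`, and solve for the
derivative of `w`. No formula for the derivative of the inverse is needed. -/
theorem vecPderiv_inv_mulVec (hu : ∀ a, DifferentiableAt ℝ (fun x => u x a) β)
    (hA : ∀ a b, DifferentiableAt ℝ (fun x => A x a b) β) (hdet : (A β).det ≠ 0) :
    vecPderiv k (fun x => (A x)⁻¹ *ᵥ u x) β =
      (A β)⁻¹ *ᵥ (vecPderiv k u β - matPderiv k A β *ᵥ ((A β)⁻¹ *ᵥ u β)) := by
  have hw := differentiableAt_mulVec (differentiableAt_inv_apply hA hdet) hu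
  have hne : ∀ᶠ x in 𝓝 β, (A x).det ≠ 0 := (differentiableAt_det hA).continuousAt.eventually_ne hdet
  have h : vecPderiv k u β = vecPderiv k (fun x => A x *ᵥ ((A x)⁻¹ *ᵥ u x)) β := by
    ext a
    refine pderiv_congr ?_
    filter_upwards [hne] with x hx
    rw [Matrix.mulVec_mulVec, Matrix.mul_nonsing_inv _ (isUnit_iff_ne_zero.2 hx), Matrix.one_mulVec]
  rw [h, vecPderiv_mulVec hA hw, add_sub_cancel_left, Matrix.mulVec_mulVec,
    Matrix.nonsing_inv_mul _ (isUnit_iff_ne_zero.2 hdet), Matrix.one_mulVec]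

/-- Symmetry of `A` moves `A⁻¹` onto the left factor `u`, so the product rule yields `u_k · w + w ·
(u_k - A_k w)`. -/
theorem pderiv_quadInv (hu : ∀ a, DifferentiableAt ℝ (fun x => u x a) β)
    (hA : ∀ a b, DifferentiableAt ℝ (fun x => A x a b) β) (hdet : (A β).det ≠ 0)
    (hsymm : (A β)ᵀ = A β) :
    pderiv k (quadInv u A) β = 2 * (vecPderiv k u β ⬝ᵥ ((A β)⁻¹ *ᵥ u β)) -
      ((A β)⁻¹ *ᵥ u β) ⬝ᵥ (matPderiv k A β *ᵥ ((A β)⁻¹ *ᵥ u β)) := by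
  have hw := differentiableAt_mulVec (differentiableAt_inv_apply hA hdet) hu
  have hsymm' : ((A β)⁻¹)ᵀ = (A β)⁻¹ := by rw [Matrix.transpose_nonsing_inv, hsymm]
  refine (pderiv_dotProduct hu hw).trans ?_
  rw [vecPderiv_inv_mulVec hu hA hdet]
  conv_lhs => rw [Matrix.dotProduct_mulVec (u β), ← Matrix.mulVec_transpose, hsymm', dotProduct_sub]
  rw [dotProduct_comm (vecPderiv k u β)]
  ring

/-- Symmetry of `A_k` merges the two terms that contain `w_j = A⁻¹ (u_j - A_j w)`. In this grouping
every summand except `u_k · A⁻¹ u_j` carries a factor `u` or `w`, hence disappears where `u = 0`. -/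
theorem pderiv_pderiv_quadInv {j : Fin q} (hu : ∀ a, ContDiffAt ℝ 2 (fun x => u x a) β)
    (hA : ∀ a b, ContDiffAt ℝ 2 (fun x => A x a b) β) (hdet : (A β).det ≠ 0)
    (hsymm : ∀ x, (A x)ᵀ = A x) :
    pderiv j (pderiv k (quadInv u A)) β =
      2 * (vecPderiv j (vecPderiv k u) β ⬝ᵥ ((A β)⁻¹ *ᵥ u β) +
        (vecPderiv k u β - matPderiv k A β *ᵥ ((A β)⁻¹ *ᵥ u β)) ⬝ᵥ
          ((A β)⁻¹ *ᵥ (vecPderiv j u β - matPderiv j A β *ᵥ ((A β)⁻¹ *ᵥ u β))) -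
        2⁻¹ * (((A β)⁻¹ *ᵥ u β) ⬝ᵥ (matPderiv j (matPderiv k A) β *ᵥ ((A β)⁻¹ *ᵥ u β)))) := by
  have hu1 := fun a => (hu a).differentiableAt two_ne_zero
  have hA1 := fun a b => (hA a b).differentiableAt two_ne_zero
  have hdu : ∀ a, DifferentiableAt ℝ (fun x => vecPderiv k u x a) β := fun a =>
    differentiableAt_pderiv (hu a)
  have hdA : ∀ a b, DifferentiableAt ℝ (fun x => matPderiv k A x a b) β := fun a b =>
    differentiableAt_pderiv (hA a b)
  have hw := differentiableAt_mulVec (differentiableAt_inv_apply hA1 hdet) hu1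
  have hdw := vecPderiv_inv_mulVec (k := j) hu1 hA1 hdet
  have hne : ∀ᶠ x in 𝓝 β, (A x).det ≠ 0 :=
    (differentiableAt_det hA1).continuousAt.eventually_ne hdet
  have hAw := differentiableAt_mulVec hdA hw
  have hdsymm : (matPderiv k A β)ᵀ = matPderiv k A β := by
    ext a b
    simp only [matPderiv, Matrix.transpose_apply, Matrix.of_apply]
    congr 1
    ext x
    exact congrFun (congrFun (hsymm x) a) b
  -- To be differentiated again, the first-order formula must hold on a neighbourhood; invertibility
  -- and differentiability both persist near `β`.
  have hfirst : pderiv k (quadInv u A) =ᶠ[𝓝 β] fun x =>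
      2 * (vecPderiv k u x ⬝ᵥ ((A x)⁻¹ *ᵥ u x)) -
        ((A x)⁻¹ *ᵥ u x) ⬝ᵥ (matPderiv k A x *ᵥ ((A x)⁻¹ *ᵥ u x)) := by
    filter_upwards [hne, eventually_all.2 fun a => eventually_differentiableAt (hu a),
      eventually_all.2 fun a => eventually_all.2 fun b => eventually_differentiableAt (hA a b)]
      with x hx hux hAx
    exact pderiv_quadInv hux hAx hx (hsymm x)
  rw [pderiv_congr hfirst, pderiv_sub ((differentiableAt_dotProduct hdu hw).const_mul 2)
    (differentiableAt_dotProduct hw hAw), pderiv_const_mul, pderiv_dotProduct hdu hw,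
    pderiv_dotProduct hw hAw, vecPderiv_mulVec hdA hw, hdw]
  set w := (A β)⁻¹ *ᵥ u β
  set w' := (A β)⁻¹ *ᵥ (vecPderiv j u β - matPderiv j A β *ᵥ w)
  have hswap : w ⬝ᵥ (matPderiv k A β *ᵥ w') = w' ⬝ᵥ (matPderiv k A β *ᵥ w) := by
    rw [Matrix.dotProduct_mulVec, ← Matrix.mulVec_transpose, hdsymm, dotProduct_comm]
  rw [dotProduct_add, hswap, sub_dotProduct, dotProduct_comm (matPderiv k A β *ᵥ w)]
  ring

end MatrixCalculus

/-! ### Derivatives of the quadratic form as continuous functions of jets. -/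

section Jets

variable {q : ℕ} {I : Type*}

/-- The index type of the partial derivatives of orders zero, one and two. -/
abbrev JetIndex (q : ℕ) : Type := Unit ⊕ Fin q ⊕ Fin q × Fin q

/-- The partial derivatives of orders zero, one and two. -/
noncomputable def jet (f : EuclideanSpace ℝ (Fin q) → ℝ) (β : EuclideanSpace ℝ (Fin q)) :
    JetIndex q → ℝ
  | .inl _ => f β
  | .inr (.inl k) => pderiv k f β
  | .inr (.inr (j, k)) => pderiv j (pderiv k f) β

theorem jet_sum {ι : Type*} (t : Finset ι) {f : ι → EuclideanSpace ℝ (Fin q) → ℝ}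
    {β : EuclideanSpace ℝ (Fin q)} (hf : ∀ i ∈ t, ContDiffAt ℝ 2 (f i) β) (c : ℝ)
    (p : JetIndex q) :
    jet (fun x => c * ∑ i ∈ t, f i x) β p = c * ∑ i ∈ t, jet (f i) β p := by
  have hd : ∀ᶠ x in 𝓝 β, ∀ i ∈ t, DifferentiableAt ℝ (f i) x :=
    (Filter.eventually_all_finset t).2 fun i hi => eventually_differentiableAt (hf i hi)
  rcases p with _ | k | ⟨j, k⟩
  · rfl
  · simp only [jet, pderiv_const_mul]
    rw [pderiv_sum _ hd.self_of_nhds]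
  · have h : pderiv k (fun x => c * ∑ i ∈ t, f i x) =ᶠ[𝓝 β]
        fun x => c * ∑ i ∈ t, pderiv k (f i) x := by
      filter_upwards [hd] with x hx
      rw [pderiv_const_mul, pderiv_sum _ hx]
    simp only [jet]
    rw [pderiv_congr h, pderiv_const_mul, pderiv_sum _ fun i hi => differentiableAt_pderiv (hf i hi)]

theorem continuousAt_jet {f : EuclideanSpace ℝ (Fin q) → ℝ} {β : EuclideanSpace ℝ (Fin q)}
    (hf : ContDiffAt ℝ 2 f β) (p : JetIndex q) : ContinuousAt (fun x => jet f x p) β := by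
  rcases p with _ | k | ⟨j, k⟩
  · exact hf.continuousAt
  · exact (differentiableAt_pderiv hf).continuousAt
  · exact (contDiffAt_pderiv (m := 0) (contDiffAt_pderiv (m := 1) (k := k) hf (by norm_num))
      (by norm_num)).continuousAt

/-- The index type for the jets of the entries of a vector and of a square matrix. -/
abbrev MomentIndex (I : Type*) (q : ℕ) : Type _ := (I ⊕ I × I) × JetIndex q

/-- The jets of the functions in a family. -/
noncomputable def jets (ψ : I ⊕ I × I → EuclideanSpace ℝ (Fin q) → ℝ)
    (β : EuclideanSpace ℝ (Fin q)) : MomentIndex I q → ℝ :=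
  fun p => jet (ψ p.1) β p.2

/-- The part of the jets that belongs to the vector and to the derivative `d`. -/
def vecPart (τ : MomentIndex I q → ℝ) (d : JetIndex q) : I → ℝ := fun a => τ (.inl a, d)

/-- The part of the jets that belongs to the matrix and to the derivative `d`. -/
def matPart (τ : MomentIndex I q → ℝ) (d : JetIndex q) : Matrix I I ℝ :=
  Matrix.of fun a b => τ (.inr (a, b), d)

theorem continuous_vecPart (d : JetIndex q) :
    Continuous fun τ : MomentIndex I q → ℝ => vecPart τ d :=
  continuous_pi fun _ => continuous_apply _

theorem continuous_matPart (d : JetIndex q) :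
    Continuous fun τ : MomentIndex I q → ℝ => matPart τ d :=
  continuous_matrix fun _ _ => continuous_apply _

variable [Fintype I]

theorem _root_.ContinuousAt.mulVec {X : Type*} [TopologicalSpace X] {A : X → Matrix I I ℝ}
    {v : X → I → ℝ} {x : X} (hA : ContinuousAt A x) (hv : ContinuousAt v x) :
    ContinuousAt (fun y => A y *ᵥ v y) x :=
  (Continuous.matrix_mulVec continuous_fst continuous_snd :
    Continuous fun p : Matrix I I ℝ × (I → ℝ) => p.1 *ᵥ p.2).continuousAt.comp (hA.prodMk hv)

theorem _root_.ContinuousAt.dotProduct {X : Type*} [TopologicalSpace X] {u v : X → I → ℝ} {x : X}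
    (hu : ContinuousAt u x) (hv : ContinuousAt v x) : ContinuousAt (fun y => u y ⬝ᵥ v y) x :=
  (Continuous.dotProduct continuous_fst continuous_snd :
    Continuous fun p : (I → ℝ) × (I → ℝ) => p.1 ⬝ᵥ p.2).continuousAt.comp (hu.prodMk hv)

variable [DecidableEq I]

/-- The value of `A⁻¹ u` in terms of the jets. -/
noncomputable def invMulVecJet (τ : MomentIndex I q → ℝ) : I → ℝ :=
  (matPart τ (.inl ()))⁻¹ *ᵥ vecPart τ (.inl ())

/-- The vector whose product with `u` is half the partial derivative of `uᵀ A⁻¹ u`, in terms of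
the jets. -/
noncomputable def halfGradCoeff (τ : MomentIndex I q → ℝ) (k : Fin q) : I → ℝ :=
  (vecPart τ (.inr (.inl k)) - (2⁻¹ : ℝ) • (matPart τ (.inr (.inl k)) *ᵥ invMulVecJet τ)) ᵥ*
    (matPart τ (.inl ()))⁻¹

/-- Half the second partial derivative of `uᵀ A⁻¹ u` in terms of the jets. -/
noncomputable def halfHess (τ : MomentIndex I q → ℝ) (j k : Fin q) : ℝ :=
  vecPart τ (.inr (.inr (j, k))) ⬝ᵥ invMulVecJet τ +
    (vecPart τ (.inr (.inl k)) - matPart τ (.inr (.inl k)) *ᵥ invMulVecJet τ) ⬝ᵥ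
      ((matPart τ (.inl ()))⁻¹ *ᵥ
        (vecPart τ (.inr (.inl j)) - matPart τ (.inr (.inl j)) *ᵥ invMulVecJet τ)) -
    2⁻¹ * (invMulVecJet τ ⬝ᵥ (matPart τ (.inr (.inr (j, k))) *ᵥ invMulVecJet τ))

theorem continuousAt_matPart_inv {τ : MomentIndex I q → ℝ} (hτ : (matPart τ (.inl ())).det ≠ 0) :
    ContinuousAt (fun τ : MomentIndex I q → ℝ => (matPart τ (.inl ()))⁻¹) τ := by
  have h := continuous_matPart (I := I) (q := q) (.inl ())
  simp only [Matrix.inv_def, Ring.inverse_eq_inv']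
  exact (h.matrix_det.continuousAt.inv₀ hτ).smul h.matrix_adjugate.continuousAt

theorem continuousAt_invMulVecJet {τ : MomentIndex I q → ℝ}
    (hτ : (matPart τ (.inl ())).det ≠ 0) : ContinuousAt (invMulVecJet (I := I) (q := q)) τ :=
  (continuousAt_matPart_inv hτ).mulVec (continuous_vecPart _).continuousAt

theorem continuousAt_halfGradCoeff {τ : MomentIndex I q → ℝ}
    (hτ : (matPart τ (.inl ())).det ≠ 0) (k : Fin q) :
    ContinuousAt (fun τ : MomentIndex I q → ℝ => halfGradCoeff τ k) τ := by
  simp only [halfGradCoeff, ← Matrix.mulVec_transpose]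
  refine ContinuousAt.mulVec ?_ ((continuous_vecPart _).continuousAt.sub
    (((continuous_matPart _).continuousAt.mulVec (continuousAt_invMulVecJet hτ)).fun_const_smul _))
  exact (continuous_id.matrix_transpose).continuousAt.comp (continuousAt_matPart_inv hτ)

theorem continuousAt_halfHess {τ : MomentIndex I q → ℝ}
    (hτ : (matPart τ (.inl ())).det ≠ 0) (j k : Fin q) :
    ContinuousAt (fun τ : MomentIndex I q → ℝ => halfHess τ j k) τ := by
  have hw := continuousAt_invMulVecJet hτ
  have hd : ∀ l, ContinuousAt (fun τ : MomentIndex I q → ℝ => vecPart τ (.inr (.inl l)) -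
      matPart τ (.inr (.inl l)) *ᵥ invMulVecJet τ) τ := fun l =>
    (continuous_vecPart _).continuousAt.sub ((continuous_matPart _).continuousAt.mulVec hw)
  exact (((continuous_vecPart _).continuousAt.dotProduct hw).add
    ((hd k).dotProduct ((continuousAt_matPart_inv hτ).mulVec (hd j)))).sub
    ((hw.dotProduct ((continuous_matPart _).continuousAt.mulVec hw)).const_mul _)

variable {ψ : I ⊕ I × I → EuclideanSpace ℝ (Fin q) → ℝ} {β : EuclideanSpace ℝ (Fin q)}

theorem pderiv_quadInv_eq_halfGradCoeff (hψ : ∀ c, ContDiffAt ℝ 2 (ψ c) β)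
    (hsymm : ∀ a b, ψ (.inr (a, b)) = ψ (.inr (b, a)))
    (hdet : (matPart (jets ψ β) (.inl ())).det ≠ 0) (k : Fin q) :
    pderiv k (quadInv (fun x a => ψ (.inl a) x) fun x => Matrix.of fun a b => ψ (.inr (a, b)) x) β =
      2 * (halfGradCoeff (jets ψ β) k ⬝ᵥ vecPart (jets ψ β) (.inl ())) := by
  rw [pderiv_quadInv (u := fun x a => ψ (.inl a) x)
    (A := fun x => Matrix.of fun a b => ψ (.inr (a, b)) x)
    (fun _ => (hψ _).differentiableAt two_ne_zero)
    (fun _ _ => (hψ _).differentiableAt two_ne_zero) hdet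
    (Matrix.ext fun a b => congrFun (hsymm b a) β)]
  rw [halfGradCoeff, ← Matrix.dotProduct_mulVec, sub_dotProduct, smul_dotProduct, smul_eq_mul,
    mul_sub, mul_inv_cancel_left₀ two_ne_zero, dotProduct_comm (_ *ᵥ invMulVecJet _)]
  rfl

theorem pderiv_pderiv_quadInv_eq_halfHess (hψ : ∀ c, ContDiffAt ℝ 2 (ψ c) β)
    (hsymm : ∀ a b, ψ (.inr (a, b)) = ψ (.inr (b, a)))
    (hdet : (matPart (jets ψ β) (.inl ())).det ≠ 0) (j k : Fin q) :
    pderiv j (pderiv k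
      (quadInv (fun x a => ψ (.inl a) x) fun x => Matrix.of fun a b => ψ (.inr (a, b)) x)) β =
      2 * halfHess (jets ψ β) j k :=
  pderiv_pderiv_quadInv (u := fun x a => ψ (.inl a) x)
    (A := fun x => Matrix.of fun a b => ψ (.inr (a, b)) x) (fun _ => hψ _)
    (fun _ _ => hψ _) hdet fun x => Matrix.ext fun a b => congrFun (hsymm b a) x

end Jets

end QIF

/-! ### Errors with conditional mean zero. -/

namespace MeasureTheory

/-- A linear combination of errors with conditional mean zero, with coefficients that are measurable
for the conditioning σ-algebra, has mean zero if it is integrable, even if its summands are not. -/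
theorem integral_sum_mul_eq_zero_of_condExp_eq_zero {𝓩 : Type*} {m m₀ : MeasurableSpace 𝓩}
    (hm : m ≤ m₀) {F : Measure 𝓩} [IsFiniteMeasure F] {ι : Type*} [Fintype ι]
    {W e : ι → 𝓩 → ℝ} (hW : ∀ t, Measurable[m] (W t)) (he : ∀ t, Integrable (e t) F)
    (hcond : ∀ t, F[e t | m] =ᵐ[F] 0) (hint : Integrable (fun z => ∑ t, W t z * e t z) F) :
    ∫ z, ∑ t, W t z * e t z ∂F = 0 := by
  let S : ℕ → Set 𝓩 := fun N => ⋂ t, {z | |W t z| ≤ N}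
  have hSm : ∀ N, MeasurableSet[m] (S N) := fun N =>
    MeasurableSet.iInter fun t => hW t (measurableSet_le measurable_id.abs measurable_const :
      MeasurableSet {x : ℝ | |x| ≤ N})
  have hmono : Monotone S := fun N N' hN z hz => by
    simp only [S, Set.mem_iInter, Set.mem_ofPred_eq] at hz ⊢
    exact fun t => (hz t).trans (by exact_mod_cast hN)
  have hunion : ⋃ N, S N = Set.univ := by
    refine Set.eq_univ_of_forall fun z => Set.mem_iUnion.2 ?_
    obtain ⟨N, hN⟩ := exists_nat_ge (∑ t, |W t z|)
    exact ⟨N, Set.mem_iInter.2 fun t =>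
      (Finset.single_le_sum (f := fun t => |W t z|) (fun _ _ => abs_nonneg _)
        (Finset.mem_univ t)).trans hN⟩
  have hlim := tendsto_setIntegral_of_monotone (μ := F) (f := fun z => ∑ t, W t z * e t z)
    (fun N => hm _ (hSm N)) hmono hint.integrableOn
  rw [hunion, setIntegral_univ] at hlim
  refine tendsto_nhds_unique hlim (tendsto_const_nhds.congr fun N => ?_)
  have hterm : ∀ t, Integrable ((S N).indicator (W t) * e t) F ∧
      ∫ z, ((S N).indicator (W t) * e t) z ∂F = 0 := fun t => by
    have hsm : StronglyMeasurable[m] ((S N).indicator (W t)) :=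
      (hW t).stronglyMeasurable.indicator (hSm N)
    have hb : ∀ z, ‖(S N).indicator (W t) z‖ ≤ N := fun z => by
      by_cases hz : z ∈ S N
      · rw [Set.indicator_of_mem hz]
        exact Set.mem_iInter.1 hz t
      · simp [Set.indicator_of_notMem hz]
    have hi : Integrable ((S N).indicator (W t) * e t) F :=
      (he t).bdd_mul (hsm.mono hm).aestronglyMeasurable (ae_of_all _ hb)
    refine ⟨hi, ?_⟩
    rw [← integral_condExp hm]
    refine integral_eq_zero_of_ae ?_
    filter_upwards [condExp_stronglyMeasurable_mul_of_bound hm hsm (he t) N (ae_of_all _ hb),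
      hcond t] with z hz hz'
    rw [hz, Pi.mul_apply, hz']
    simp
  rw [← integral_indicator (hm _ (hSm N))]
  have : (S N).indicator (fun z => ∑ t, W t z * e t z) =
      fun z => ∑ t, ((S N).indicator (W t) * e t) z := by
    ext z
    by_cases hz : z ∈ S N
    · simp [hz]
    · simp [hz]
  rw [this, integral_finsetSum _ fun t _ => (hterm t).1]
  exact (Finset.sum_eq_zero fun t _ => (hterm t).2).symm

end MeasureTheory

namespace QIF

/-! ### Measurability of partial derivatives in the data. -/

section Measurability

variable {q : ℕ} {𝓩 : Type*} [MeasurableSpace 𝓩] {F : Measure 𝓩}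

/-- The upper limit of the difference quotients along a coordinate direction. -/
noncomputable def upperPderiv (k : Fin q) (f : EuclideanSpace ℝ (Fin q) → ℝ)
    (β : EuclideanSpace ℝ (Fin q)) : ℝ :=
  limsup (fun n : ℕ => (n : ℝ) • (f (β + (n : ℝ)⁻¹ • EuclideanSpace.single k 1) - f β)) atTop

theorem upperPderiv_eq_pderiv {k : Fin q} {f : EuclideanSpace ℝ (Fin q) → ℝ}
    {β : EuclideanSpace ℝ (Fin q)} (hf : DifferentiableAt ℝ f β) :
    upperPderiv k f β = pderiv k f β :=
  ((hf.hasFDerivAt.lim_real (EuclideanSpace.single k 1)).comp tendsto_natCast_atTop_atTop).limsup_eq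

/-- A countable upper limit needs measurability only at each fixed parameter, and no smoothness. It
can therefore be iterated to reach second derivatives. -/
theorem measurable_upperPderiv {f : 𝓩 → EuclideanSpace ℝ (Fin q) → ℝ}
    (hf : ∀ β, Measurable fun z => f z β) (k : Fin q) (β : EuclideanSpace ℝ (Fin q)) :
    Measurable fun z => upperPderiv k (f z) β :=
  Measurable.limsup fun _ => ((hf _).sub (hf _)).const_mul (_ : ℝ)

theorem upperPderiv_congr {k : Fin q} {f g : EuclideanSpace ℝ (Fin q) → ℝ}
    {β : EuclideanSpace ℝ (Fin q)} (h : f =ᶠ[𝓝 β] g) : upperPderiv k f β = upperPderiv k g β := by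
  have ht : Tendsto (fun n : ℕ => β + (n : ℝ)⁻¹ • EuclideanSpace.single k (1 : ℝ)) atTop (𝓝 β) := by
    have := (tendsto_inv_atTop_nhds_zero_nat (𝕜 := ℝ)).smul_const (EuclideanSpace.single k (1 : ℝ))
    simpa using this.const_add β
  refine limsup_congr ?_
  filter_upwards [ht.eventually h] with n hn
  rw [hn, h.self_of_nhds]

theorem aemeasurable_jet {f : 𝓩 → EuclideanSpace ℝ (Fin q) → ℝ}
    (hf : ∀ β, Measurable fun z => f z β) {β : EuclideanSpace ℝ (Fin q)}
    (hsmooth : ∀ᵐ z ∂F, ContDiffAt ℝ 2 (f z) β) (p : JetIndex q) :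
    AEMeasurable (fun z => jet (f z) β p) F := by
  rcases p with _ | k | ⟨j, k⟩
  · exact (hf β).aemeasurable
  · refine (measurable_upperPderiv hf k β).aemeasurable.congr ?_
    filter_upwards [hsmooth] with z hz
    exact upperPderiv_eq_pderiv (hz.differentiableAt two_ne_zero)
  · refine (measurable_upperPderiv (measurable_upperPderiv hf k) j β).aemeasurable.congr ?_
    filter_upwards [hsmooth] with z hz
    rw [upperPderiv_congr (g := pderiv k (f z)), upperPderiv_eq_pderiv (differentiableAt_pderiv hz)]
    · rfl
    · filter_upwards [eventually_differentiableAt hz] with x hx using upperPderiv_eq_pderiv hx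

end Measurability

/-! ### The score and the quadratic inference function. -/

section Model

variable {n q s : ℕ} (m : Model n s)

/-- The chain rule persists where `h` is not differentiable, since then both sides are `0`.
Measurability of the score follows from it, because `deriv h` is always measurable. -/
theorem pderiv_comp_inner (h : ℝ → ℝ) (x β : EuclideanSpace ℝ (Fin q)) (k : Fin q) :
    pderiv k (fun b => h (inner ℝ x b)) β = deriv h (inner ℝ x β) * x k := by
  by_cases hd : DifferentiableAt ℝ h (inner ℝ x β)
  · have hc : HasFDerivAt (fun b => h (inner ℝ x b)) (deriv h (inner ℝ x β) • innerSL ℝ x) β :=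
      hd.hasDerivAt.comp_hasFDerivAt β (innerSL ℝ x).hasFDerivAt
    simp only [pderiv, hc.fderiv]
    simp [EuclideanSpace.inner_single_right]
  · rw [deriv_zero_of_not_differentiableAt hd, zero_mul]
    by_cases hx : x = 0
    · simp [pderiv, hx]
    · simp only [pderiv]
      rw [fderiv_zero_of_not_differentiableAt]
      · rfl
      · intro hcomp
        apply hd
        -- Along this line the inner product with `x` equals `r`, so differentiability of the
        -- composite would force that of `h`.
        have hline : DifferentiableAt ℝ
            (fun r : ℝ => β + ((r - inner ℝ x β) * (‖x‖ ^ 2)⁻¹) • x) (inner ℝ x β) := by fun_prop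
        have hcomp' : DifferentiableAt ℝ (fun b => h (inner ℝ x b))
            (β + ((inner ℝ x β - inner ℝ x β) * (‖x‖ ^ 2)⁻¹) • x) := by simpa using hcomp
        have := hcomp'.comp (inner ℝ x β) hline
        refine this.congr_of_eventuallyEq (Eventually.of_forall fun r => ?_)
        have hx2 : ‖x‖ ^ 2 ≠ 0 := by simpa using hx
        simp [inner_add_right, inner_smul_right, hx2]

/-- The weight of the residual at time `t` in the component `a` of the score. -/
noncomputable def scoreWeight (x : Fin n → EuclideanSpace ℝ (Fin q))
    (β : EuclideanSpace ℝ (Fin q)) (a : Fin s × Fin q) (t : Fin n) : ℝ :=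
  ((gradMean m x β)ᵀ * invSqrtVar m x β * m.M a.1 * invSqrtVar m x β) a.2 t

theorem score_eq_sum (z : Obs n q) (β : EuclideanSpace ℝ (Fin q)) (a : Fin s × Fin q) :
    score m z β a = ∑ t, scoreWeight m z.2 β a t * (z.1 t - m.h (inner ℝ (z.2 t) β)) := rfl

theorem measurable_scoreWeight {m : Model n s} (hv : Measurable m.v)
    (β : EuclideanSpace ℝ (Fin q)) (a : Fin s × Fin q) (t : Fin n) :
    Measurable fun x : Fin n → EuclideanSpace ℝ (Fin q) => scoreWeight m x β a t := by
  have hin : ∀ t, Measurable fun x : Fin n → EuclideanSpace ℝ (Fin q) => (inner ℝ (x t) β : ℝ) :=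
    fun t => (measurable_pi_apply t).inner measurable_const
  have hA : ∀ t, Measurable fun x : Fin n → EuclideanSpace ℝ (Fin q) =>
      (√(m.φ * m.v (inner ℝ (x t) β)))⁻¹ := fun t =>
    ((hv.comp (hin t)).const_mul m.φ).sqrt.inv
  have hD : ∀ t k, Measurable fun x : Fin n → EuclideanSpace ℝ (Fin q) => gradMean m x β t k :=
    fun t k => by
      simp only [gradMean, meanVec, Matrix.of_apply, pderiv_comp_inner]
      exact ((measurable_deriv m.h).comp (hin t)).mul (by fun_prop)
  simp only [scoreWeight, invSqrtVar, Matrix.mul_diagonal]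
  refine Measurable.mul ?_ (hA t)
  simp only [Matrix.mul_apply (N := m.M a.1), Matrix.mul_diagonal, Matrix.transpose_apply]
  exact Finset.measurable_fun_sum _ fun t' _ => ((hD t' a.2).mul (hA t')).mul_const _

theorem measurable_score {m : Model n s} (hh : Measurable m.h) (hv : Measurable m.v)
    (β : EuclideanSpace ℝ (Fin q)) (a : Fin s × Fin q) :
    Measurable fun z : Obs n q => score m z β a := by
  simp only [score_eq_sum]
  refine Finset.measurable_fun_sum _ fun t _ => ?_
  refine ((measurable_scoreWeight hv β a t).comp measurable_snd).mul ?_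
  refine ((measurable_pi_apply t).comp measurable_fst).sub (hh.comp ?_)
  exact ((measurable_pi_apply t).comp measurable_snd).inner measurable_const

/-- Each score component is a sum of residuals with weights that depend only on the covariates, and
the residuals are conditionally centred at `β₀`. Only the sum is assumed integrable, hence the
truncated form of the argument. -/
theorem integral_score_eq_zero {m : Model n s} (hh : Measurable m.h) (hv : Measurable m.v)
    {β₀ : EuclideanSpace ℝ (Fin q)} {F : Measure (Obs n q)} [IsProbabilityMeasure F]
    (hint : ∀ t, Integrable (fun z : Obs n q => z.1 t) F)
    (hmean : ∀ t, F[fun z : Obs n q => z.1 t | MeasurableSpace.comap Prod.snd inferInstance]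
      =ᵐ[F] fun z => m.h (inner ℝ (z.2 t) β₀))
    {a : Fin s × Fin q} (ha : Integrable (fun z => score m z β₀ a) F) :
    ∫ z, score m z β₀ a ∂F = 0 := by
  have hle : MeasurableSpace.comap (Prod.snd : Obs n q → _) inferInstance ≤
    (inferInstance : MeasurableSpace (Obs n q)) := measurable_snd.comap_le
  have hμm : ∀ t, Measurable fun x : Fin n → EuclideanSpace ℝ (Fin q) =>
      m.h (inner ℝ (x t) β₀) := fun t =>
    hh.comp ((measurable_pi_apply t).inner measurable_const)
  have hμi : ∀ t, Integrable (fun z : Obs n q => m.h (inner ℝ (z.2 t) β₀)) F := fun t =>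
    integrable_condExp.congr (hmean t)
  simp only [score_eq_sum] at ha ⊢
  refine integral_sum_mul_eq_zero_of_condExp_eq_zero hle
    (W := fun t z => scoreWeight m z.2 β₀ a t)
    (e := fun t z => z.1 t - m.h (inner ℝ (z.2 t) β₀))
    (fun t => (measurable_scoreWeight hv β₀ a t).comp (comap_measurable _))
    (fun t => (hint t).sub (hμi t)) (fun t => ?_) ha
  have hself : F[fun z : Obs n q => m.h (inner ℝ (z.2 t) β₀) |
      MeasurableSpace.comap Prod.snd inferInstance] = fun z => m.h (inner ℝ (z.2 t) β₀) :=
    condExp_of_stronglyMeasurable hle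
    (((hμm t).comp (comap_measurable _)).stronglyMeasurable) (hμi t)
  have hsub := condExp_sub (hint t) (hμi t)
    (MeasurableSpace.comap (Prod.snd : Obs n q → _) inferInstance)
  filter_upwards [hsub, hmean t] with z h1 h2
  refine h1.trans ?_
  rw [Pi.sub_apply, h2, hself]
  simp

/-- The score components and their products. -/
noncomputable def scoreMoments (z : Obs n q) :
    (Fin s × Fin q) ⊕ (Fin s × Fin q) × (Fin s × Fin q) → EuclideanSpace ℝ (Fin q) → ℝ
  | .inl a => fun β => score m z β a
  | .inr (a, b) => fun β => score m z β a * score m z β b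

theorem measurable_scoreMoments {m : Model n s} (hh : Measurable m.h) (hv : Measurable m.v)
    (c : (Fin s × Fin q) ⊕ (Fin s × Fin q) × (Fin s × Fin q)) (β : EuclideanSpace ℝ (Fin q)) :
    Measurable fun z : Obs n q => scoreMoments m z c β := by
  rcases c with a | ⟨a, b⟩
  · exact measurable_score hh hv β a
  · exact (measurable_score hh hv β a).mul (measurable_score hh hv β b)

theorem contDiffAt_scoreMoments {m : Model n s} {z : Obs n q} {β : EuclideanSpace ℝ (Fin q)}
    (h : ContDiffAt ℝ 2 (score m z) β)
    (c : (Fin s × Fin q) ⊕ (Fin s × Fin q) × (Fin s × Fin q)) :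
    ContDiffAt ℝ 2 (scoreMoments m z c) β := by
  have h' := contDiffAt_pi.1 h
  rcases c with a | ⟨a, b⟩
  · exact h' a
  · exact (h' a).mul (h' b)

/-- The empirical means of the score components and of their products. -/
noncomputable def meanMoments (N : ℕ) (z : ℕ → Obs n q)
    (c : (Fin s × Fin q) ⊕ (Fin s × Fin q) × (Fin s × Fin q))
    (β : EuclideanSpace ℝ (Fin q)) : ℝ :=
  (N : ℝ)⁻¹ * ∑ i ∈ Finset.range N, scoreMoments m (z i) c β

theorem meanMoments_inl (N : ℕ) (z : ℕ → Obs n q) (β : EuclideanSpace ℝ (Fin q))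
    (a : Fin s × Fin q) : meanMoments m N z (.inl a) β = scoreMean m N z β a := by
  simp [meanMoments, scoreMean, scoreMoments, Finset.sum_apply]

theorem meanMoments_inr (N : ℕ) (z : ℕ → Obs n q) (β : EuclideanSpace ℝ (Fin q))
    (a b : Fin s × Fin q) : meanMoments m N z (.inr (a, b)) β = secondMomentHat m N z β a b := by
  simp [meanMoments, secondMomentHat, scoreMoments, Matrix.sum_apply, Matrix.vecMulVec_apply]

theorem meanMoments_symm (N : ℕ) (z : ℕ → Obs n q) (a b : Fin s × Fin q) :
    meanMoments m N z (.inr (a, b)) = meanMoments m N z (.inr (b, a)) := by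
  ext β
  simp [meanMoments, scoreMoments, mul_comm]

theorem jets_meanMoments (N : ℕ) {z : ℕ → Obs n q} {β : EuclideanSpace ℝ (Fin q)}
    (hz : ∀ i, ContDiffAt ℝ 2 (score m (z i)) β) :
    jets (meanMoments m N z) β =
      (N : ℝ)⁻¹ • ∑ i ∈ Finset.range N, jets (scoreMoments m (z i)) β := by
  ext p
  rw [Pi.smul_apply, Finset.sum_apply]
  exact jet_sum _ (fun i _ => contDiffAt_scoreMoments (hz i) _) _ _

theorem contDiffAt_meanMoments (N : ℕ) {z : ℕ → Obs n q} {β : EuclideanSpace ℝ (Fin q)}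
    (hz : ∀ i, ContDiffAt ℝ 2 (score m (z i)) β)
    (c : (Fin s × Fin q) ⊕ (Fin s × Fin q) × (Fin s × Fin q)) :
    ContDiffAt ℝ 2 (meanMoments m N z c) β :=
  contDiffAt_const.mul (ContDiffAt.sum fun i _ => contDiffAt_scoreMoments (hz i) c)

theorem vecPart_jets_meanMoments (N : ℕ) (z : ℕ → Obs n q) (β : EuclideanSpace ℝ (Fin q)) :
    vecPart (jets (meanMoments m N z) β) (.inl ()) = scoreMean m N z β :=
  funext fun a => meanMoments_inl m N z β a

theorem matPart_jets_meanMoments (N : ℕ) (z : ℕ → Obs n q) (β : EuclideanSpace ℝ (Fin q)) :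
    matPart (jets (meanMoments m N z) β) (.inl ()) = secondMomentHat m N z β :=
  Matrix.ext fun a b => meanMoments_inr m N z β a b

theorem qif_eq_quadInv (N : ℕ) (z : ℕ → Obs n q) :
    qif m N z = fun β => (N : ℝ) * quadInv (fun x a => meanMoments m N z (.inl a) x)
      (fun x => Matrix.of fun a b => meanMoments m N z (.inr (a, b)) x) β := by
  ext β
  have h1 : (fun a => meanMoments m N z (.inl a) β) = scoreMean m N z β :=
    vecPart_jets_meanMoments m N z β
  have h2 : (Matrix.of fun a b => meanMoments m N z (.inr (a, b)) β) = secondMomentHat m N z β :=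
    matPart_jets_meanMoments m N z β
  rw [quadInv, h1, h2, qif]

theorem posSemidef_secondMomentHat (N : ℕ) (z : ℕ → Obs n q) (β : EuclideanSpace ℝ (Fin q)) :
    (secondMomentHat m N z β).PosSemidef := by
  refine Matrix.PosSemidef.smul (Matrix.posSemidef_sum _ fun i _ => ?_) (by positivity)
  simpa using Matrix.posSemidef_vecMulVec_self_star (score m (z i) β)

theorem qif_nonneg (N : ℕ) (z : ℕ → Obs n q) (β : EuclideanSpace ℝ (Fin q)) :
    0 ≤ qif m N z β := by
  refine mul_nonneg N.cast_nonneg ?_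
  simpa using (posSemidef_secondMomentHat m N z β).inv.dotProduct_mulVec_nonneg (scoreMean m N z β)

/-- Where the second moment estimator is singular, the quadratic inference function has a minimum,
so that its partial derivatives are zero. -/
theorem pderiv_qif_of_det_eq_zero {N : ℕ} {z : ℕ → Obs n q} {β : EuclideanSpace ℝ (Fin q)}
    (h : (secondMomentHat m N z β).det = 0) (k : Fin q) : pderiv k (qif m N z) β = 0 := by
  have hz : qif m N z β = 0 := by
    rw [qif, Matrix.nonsing_inv_apply_not_isUnit _ (by simp [h])]
    simp
  have hmin : IsLocalMin (qif m N z) β :=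
    Eventually.of_forall fun x => hz.trans_le (qif_nonneg m N z x)
  rw [pderiv, hmin.fderiv_eq_zero]
  rfl

/-- Nonsingularity is not needed: at a singular point the left side is `0` by minimality and the
right side because the inverse is `0`. The gradient identity is thus exact for every `N`. -/
theorem pderiv_qif {N : ℕ} {z : ℕ → Obs n q} {β : EuclideanSpace ℝ (Fin q)}
    (hz : ∀ i, ContDiffAt ℝ 2 (score m (z i)) β) (k : Fin q) :
    pderiv k (qif m N z) β = 2 * N *
      (halfGradCoeff (jets (meanMoments m N z) β) k ⬝ᵥ scoreMean m N z β) := by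
  by_cases h : (secondMomentHat m N z β).det = 0
  · rw [pderiv_qif_of_det_eq_zero m h, halfGradCoeff, matPart_jets_meanMoments,
      Matrix.nonsing_inv_apply_not_isUnit _ (by simp [h])]
    simp
  · rw [qif_eq_quadInv, pderiv_const_mul, pderiv_quadInv_eq_halfGradCoeff
      (contDiffAt_meanMoments m N hz) (meanMoments_symm m N z)
      (by rwa [matPart_jets_meanMoments]), vecPart_jets_meanMoments]
    ring

theorem hess_qif {N : ℕ} {z : ℕ → Obs n q} {β : EuclideanSpace ℝ (Fin q)}
    (hz : ∀ i, ContDiffAt ℝ 2 (score m (z i)) β)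
    (hdet : (secondMomentHat m N z β).det ≠ 0) (j k : Fin q) :
    hess (qif m N z) β j k = 2 * N * halfHess (jets (meanMoments m N z) β) j k := by
  have h : pderiv k (qif m N z) = fun x => (N : ℝ) * pderiv k
      (quadInv (fun x a => meanMoments m N z (.inl a) x)
        fun x => Matrix.of fun a b => meanMoments m N z (.inr (a, b)) x) x := by
    ext x
    rw [qif_eq_quadInv, pderiv_const_mul]
  rw [hess, Matrix.of_apply, h, pderiv_const_mul, pderiv_pderiv_quadInv_eq_halfHess
    (contDiffAt_meanMoments m N hz) (meanMoments_symm m N z)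
    (by rwa [matPart_jets_meanMoments])]
  ring

end Model

end QIF

/-! ### Linear images of Gaussian laws. -/

namespace ProbabilityTheory

/-- Compare characteristic functions: the one of the image at `t` is the original one at `Cᵀ t`. -/
theorem map_mulVec_multivariateGaussian {ι κ : Type*} [Fintype ι] [DecidableEq ι] [Fintype κ]
    [DecidableEq κ] (C : Matrix κ ι ℝ) {S : Matrix ι ι ℝ} (hS : S.PosSemidef) :
    (multivariateGaussian 0 S).map (fun x => WithLp.toLp 2 (C *ᵥ x.ofLp)) =
      multivariateGaussian 0 (C * S * Cᵀ) := by
  have hm : Measurable fun x : EuclideanSpace ℝ ι =>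
      (WithLp.toLp 2 (C *ᵥ x.ofLp) : EuclideanSpace ℝ κ) := by
    have : Continuous fun x : EuclideanSpace ℝ ι =>
        (WithLp.toLp 2 (C *ᵥ x.ofLp) : EuclideanSpace ℝ κ) :=
      (PiLp.continuous_toLp 2 _).comp
        (Continuous.matrix_mulVec continuous_const (PiLp.continuous_ofLp 2 _))
    exact this.measurable
  have hC : (C * S * Cᵀ).PosSemidef := by
    simpa using hS.mul_mul_conjTranspose_same C
  have : IsProbabilityMeasure ((multivariateGaussian 0 S).map
      (fun x => (WithLp.toLp 2 (C *ᵥ x.ofLp) : EuclideanSpace ℝ κ))) :=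
    Measure.isProbabilityMeasure_map hm.aemeasurable
  refine Measure.ext_of_charFun (funext fun t => ?_)
  have hadj : ∀ x : EuclideanSpace ℝ ι,
      inner ℝ (WithLp.toLp 2 (C *ᵥ x.ofLp) : EuclideanSpace ℝ κ) t =
        inner ℝ x (WithLp.toLp 2 (Cᵀ *ᵥ t.ofLp) : EuclideanSpace ℝ ι) := fun x => by
    simp only [EuclideanSpace.inner_eq_star_dotProduct, star_trivial]
    rw [Matrix.dotProduct_mulVec, ← Matrix.mulVec_transpose]
  have hchar : charFun ((multivariateGaussian 0 S).map
      (fun x => (WithLp.toLp 2 (C *ᵥ x.ofLp) : EuclideanSpace ℝ κ))) t =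
      charFun (multivariateGaussian 0 S) (WithLp.toLp 2 (Cᵀ *ᵥ t.ofLp)) := by
    rw [charFun_apply, charFun_apply, integral_map hm.aemeasurable (by fun_prop)]
    simp only [hadj]
  rw [hchar, charFun_multivariateGaussian hS, charFun_multivariateGaussian hC]
  simp only [inner_zero_right, ← Matrix.mulVec_mulVec, Matrix.dotProduct_mulVec _ C,
    ← Matrix.mulVec_transpose C]

theorem TendstoInDistribution.of_map_eq {ι E Ω' : Type*} {Ω : ι → Type*}
    {mΩ : ∀ i, MeasurableSpace (Ω i)} {μ : (i : ι) → Measure (Ω i)}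
    [∀ i, IsProbabilityMeasure (μ i)] {mΩ' : MeasurableSpace Ω'} {μ' : Measure Ω'}
    [IsProbabilityMeasure μ'] [TopologicalSpace E] [MeasurableSpace E] [OpensMeasurableSpace E]
    {X : (i : ι) → Ω i → E} {l : Filter ι} {Y : Ω' → E} {ν : Measure E} [IsProbabilityMeasure ν]
    (h : TendstoInDistribution X l Y μ μ') (hν : μ'.map Y = ν) :
    TendstoInDistribution X l id μ ν := by
  refine ⟨h.forall_aemeasurable, aemeasurable_id, ?_⟩
  convert h.tendsto using 2
  simp [hν]

end ProbabilityTheory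

namespace QIF

/-! ### Measurability, special values and uniform continuity of the jet functions. -/

section Measurability

variable {q : ℕ} {I : Type*} [Fintype I] [DecidableEq I]

theorem measurable_matPart_inv (a b : I) :
    Measurable fun τ : MomentIndex I q → ℝ => (matPart τ (.inl ()))⁻¹ a b := by
  have h := continuous_matPart (I := I) (q := q) (.inl ())
  simp only [Matrix.inv_def, Ring.inverse_eq_inv', Matrix.smul_apply, smul_eq_mul]
  exact h.matrix_det.measurable.inv.mul (h.matrix_adjugate.matrix_elem a b).measurable

theorem measurable_halfGradCoeff (k : Fin q) (b : I) :
    Measurable fun τ : MomentIndex I q → ℝ => halfGradCoeff τ k b := by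
  have hv : ∀ d a, Measurable fun τ : MomentIndex I q → ℝ => vecPart τ d a := fun d a =>
    measurable_pi_apply _
  have hm : ∀ d a b, Measurable fun τ : MomentIndex I q → ℝ => matPart τ d a b := fun d a b =>
    measurable_pi_apply _
  simp only [halfGradCoeff, invMulVecJet, Matrix.vecMul, Matrix.mulVec, dotProduct, Pi.sub_apply,
    Pi.smul_apply, smul_eq_mul]
  refine Finset.measurable_fun_sum _ fun a _ => Measurable.mul ?_ (measurable_matPart_inv _ _)
  refine (hv _ _).sub (Measurable.const_mul (Finset.measurable_fun_sum _ fun c _ => ?_) _)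
  exact (hm _ _ _).mul
    (Finset.measurable_fun_sum _ fun d _ => (measurable_matPart_inv _ _).mul (hv _ _))

theorem halfGradCoeff_of_vecPart_eq_zero {τ : MomentIndex I q → ℝ}
    (h : vecPart τ (.inl ()) = 0) (k : Fin q) :
    halfGradCoeff τ k = vecPart τ (.inr (.inl k)) ᵥ* (matPart τ (.inl ()))⁻¹ := by
  simp [halfGradCoeff, invMulVecJet, h]

theorem halfHess_of_vecPart_eq_zero {τ : MomentIndex I q → ℝ}
    (h : vecPart τ (.inl ()) = 0) (j k : Fin q) :
    halfHess τ j k = vecPart τ (.inr (.inl k)) ⬝ᵥ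
      ((matPart τ (.inl ()))⁻¹ *ᵥ vecPart τ (.inr (.inl j))) := by
  simp [halfHess, invMulVecJet, h]

/-- Uniformly close jets have uniformly close values of `halfHess`, near a compact set of jets with
invertible matrices. -/
theorem exists_forall_dist_lt_halfHess {S : Set (MomentIndex I q → ℝ)} (hS : IsCompact S)
    (hdet : ∀ τ ∈ S, (matPart τ (.inl ())).det ≠ 0) {ε : ℝ} (hε : 0 < ε) :
    ∃ δ > 0, ∀ τ ∈ S, ∀ σ, dist σ τ < δ → (matPart σ (.inl ())).det ≠ 0 ∧
      ∀ j k, |halfHess σ j k - halfHess τ j k| < ε := by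
  have hopen : IsOpen {τ : MomentIndex I q → ℝ | (matPart τ (.inl ())).det ≠ 0} :=
    isOpen_ne_fun (continuous_matPart _).matrix_det continuous_const
  obtain ⟨δ₁, hδ₁, hsub⟩ := hS.exists_thickening_subset_open hopen hdet
  -- Only one of the two points has to lie in `S`; empirical jets are near the compact set but need
  -- not belong to it.
  have hunif := hS.uniformContinuousAt_of_continuousAt
    (fun (τ : MomentIndex I q → ℝ) (p : Fin q × Fin q) => halfHess τ p.1 p.2)
    (fun τ hτ => continuousAt_pi.2 fun p => continuousAt_halfHess (hdet τ hτ) p.1 p.2)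
    (Metric.dist_mem_uniformity hε)
  obtain ⟨δ₂, hδ₂, hδ⟩ := Metric.mem_uniformity_dist.1 hunif
  refine ⟨min δ₁ δ₂, lt_min hδ₁ hδ₂, fun τ hτ σ hσ => ⟨?_, fun j k => ?_⟩⟩
  · exact hsub (Metric.mem_thickening_iff.2 ⟨τ, hτ, hσ.trans_le (min_le_left _ _)⟩)
  · have h := hδ (a := τ) (b := σ) (by rw [dist_comm]; exact hσ.trans_le (min_le_right _ _)) hτ
    rw [← Real.dist_eq, dist_comm]
    exact (dist_le_pi_dist _ _ (j, k)).trans_lt h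

end Measurability

/-! ### Asymptotics of the gradient and the Hessian. -/

section Asymptotics

variable {n q s : ℕ} {m : Model n s} {B : Set (EuclideanSpace ℝ (Fin q))}
  {F : Measure (Obs n q)} {Ω : Type*} [MeasurableSpace Ω] {P : Measure Ω} {Z : ℕ → Ω → Obs n q}

/-- The means of the jets of the score components and of their products. -/
noncomputable def momentJets (m : Model n s) (F : Measure (Obs n q))
    (β : EuclideanSpace ℝ (Fin q)) : MomentIndex (Fin s × Fin q) q → ℝ :=
  ∫ z, jets (scoreMoments m z) β ∂F

theorem aemeasurable_jets (hh : Measurable m.h) (hv : Measurable m.v)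
    (hsmooth : ∀ᵐ z ∂F, ∀ β ∈ B, ContDiffAt ℝ 2 (score m z) β)
    {β : EuclideanSpace ℝ (Fin q)} (hβ : β ∈ B) :
    AEMeasurable (fun z => jets (scoreMoments m z) β) F :=
  aemeasurable_pi_iff.2 fun p => aemeasurable_jet (fun β => measurable_scoreMoments hh hv p.1 β)
    (hsmooth.mono fun _ hz => contDiffAt_scoreMoments (hz β hβ) p.1) p.2

theorem exists_envelope_jets (hdom : ∀ a, DominatedUpToOrderTwo F B fun z β => score m z β a)
    (hdom₂ : ∀ a b, DominatedUpToOrderTwo F B fun z β => score m z β a * score m z β b)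
    {K : Set (EuclideanSpace ℝ (Fin q))} (hKB : K ⊆ B) (hK : IsCompact K) :
    ∃ env : Obs n q → ℝ, Integrable env F ∧
      ∀ᵐ z ∂F, ∀ β ∈ K, ‖jets (scoreMoments m z) β‖ ≤ env z := by
  have h : ∀ c, DominatedUpToOrderTwo F B fun z => scoreMoments m z c := by
    rintro (a | ⟨a, b⟩)
    · exact hdom a
    · exact hdom₂ a b
  choose env henv hle using fun c => h c K hKB hK
  refine ⟨fun z => ∑ c, env c z, integrable_finsetSum _ fun c _ => henv c, ?_⟩
  filter_upwards [ae_all_iff.2 hle] with z hz β hβ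
  have hnn : ∀ c, 0 ≤ env c z := fun c => (abs_nonneg _).trans (hz c β hβ).1
  refine (pi_norm_le_iff_of_nonneg (Finset.sum_nonneg fun c _ => hnn c)).2 fun p => ?_
  refine le_trans ?_ (Finset.single_le_sum (f := fun c => env c z) (fun c _ => hnn c)
    (Finset.mem_univ p.1))
  obtain ⟨h0, h1, h2⟩ := hz p.1 β hβ
  rcases p with ⟨c, _ | k | ⟨j, k⟩⟩
  · exact h0
  · exact h1 k
  · exact h2 j k

theorem uniform_law_jets (hh : Measurable m.h) (hv : Measurable m.v)
    (hlaw : ∀ i, HasLaw (Z i) F P) (hindep : iIndepFun Z P)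
    (hsmooth : ∀ᵐ z ∂F, ∀ β ∈ B, ContDiffAt ℝ 2 (score m z) β)
    (hdom : ∀ a, DominatedUpToOrderTwo F B fun z β => score m z β a)
    (hdom₂ : ∀ a b, DominatedUpToOrderTwo F B fun z β => score m z β a * score m z β b)
    {K : Set (EuclideanSpace ℝ (Fin q))} (hKB : K ⊆ B) (hK : IsCompact K) :
    ContinuousOn (momentJets m F) K ∧
      ∃ D : ℕ → Ω → ℝ, (∀ N, AEMeasurable (D N) P) ∧
        (∀ᵐ ω ∂P, Tendsto (fun N => D N ω) atTop (𝓝 0)) ∧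
        ∀ᵐ ω ∂P, ∀ N : ℕ, ∀ β ∈ K,
          dist (jets (meanMoments m N fun i => Z i ω) β) (momentJets m F β) ≤ D N ω := by
  obtain ⟨env, henv, hle⟩ := exists_envelope_jets hdom hdom₂ hKB hK
  obtain ⟨hc, D, hDm, hD0, hD⟩ := uniform_law_of_large_numbers hlaw hindep hK
    (T := fun z => jets (scoreMoments m z))
    (fun β hβ => aemeasurable_jets hh hv hsmooth (hKB hβ))
    (hsmooth.mono fun z hz β hβ => (continuousAt_pi.2
      fun p : MomentIndex (Fin s × Fin q) q => continuousAt_jet (contDiffAt_scoreMoments (hz β (hKB hβ)) p.1)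
        p.2).continuousWithinAt)
    henv hle
  refine ⟨hc, D, hDm, hD0, ?_⟩
  filter_upwards [hD, ae_forall_of_hasLaw hlaw hsmooth] with ω hω hs N β hβ
  rw [jets_meanMoments m N fun i => hs i β (hKB hβ)]
  exact hω N β hβ

/-- Domination is available on compact subsets only, and `B` need not be locally compact. A
convergent sequence in `B` together with its limit is compact, which is enough for sequential
continuity. -/
theorem continuousOn_momentJets (hh : Measurable m.h) (hv : Measurable m.v)
    (hlaw : ∀ i, HasLaw (Z i) F P) (hindep : iIndepFun Z P)
    (hsmooth : ∀ᵐ z ∂F, ∀ β ∈ B, ContDiffAt ℝ 2 (score m z) β)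
    (hdom : ∀ a, DominatedUpToOrderTwo F B fun z β => score m z β a)
    (hdom₂ : ∀ a b, DominatedUpToOrderTwo F B fun z β => score m z β a * score m z β b) :
    ContinuousOn (momentJets m F) B := by
  intro β hβ
  refine tendsto_of_seq_tendsto fun u hu => ?_
  obtain ⟨hu1, hu2⟩ := tendsto_nhdsWithin_iff.1 hu
  obtain ⟨N, hN⟩ := eventually_atTop.1 hu2
  have hlim : Tendsto (fun i => u (i + N)) atTop (𝓝 β) := (tendsto_add_atTop_iff_nat N).2 hu1
  have hc := (uniform_law_jets hh hv hlaw hindep hsmooth hdom hdom₂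
    (Set.insert_subset hβ (Set.range_subset_iff.2 fun i => hN _ (Nat.le_add_left _ _)))
    hlim.isCompact_insert_range).1
  refine (tendsto_add_atTop_iff_nat N).1 ((hc β (Set.mem_insert _ _)).tendsto.comp ?_)
  exact tendsto_nhdsWithin_iff.2 ⟨hlim, Eventually.of_forall fun i =>
    Set.mem_insert_of_mem _ (Set.mem_range_self i)⟩

theorem integrable_jets (hh : Measurable m.h) (hv : Measurable m.v)
    (hsmooth : ∀ᵐ z ∂F, ∀ β ∈ B, ContDiffAt ℝ 2 (score m z) β)
    (hdom : ∀ a, DominatedUpToOrderTwo F B fun z β => score m z β a)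
    (hdom₂ : ∀ a b, DominatedUpToOrderTwo F B fun z β => score m z β a * score m z β b)
    {β : EuclideanSpace ℝ (Fin q)} (hβ : β ∈ B) :
    Integrable (fun z => jets (scoreMoments m z) β) F := by
  obtain ⟨env, henv, hle⟩ := exists_envelope_jets hdom hdom₂ (Set.singleton_subset_iff.2 hβ)
    isCompact_singleton
  exact henv.mono' (aemeasurable_jets hh hv hsmooth hβ).aestronglyMeasurable
    (hle.mono fun z hz => hz β rfl)

theorem momentJets_apply {β : EuclideanSpace ℝ (Fin q)}
    (hint : Integrable (fun z => jets (scoreMoments m z) β) F)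
    (p : MomentIndex (Fin s × Fin q) q) :
    momentJets m F β p = ∫ z, jet (scoreMoments m z p.1) β p.2 ∂F :=
  eval_integral (fun p => hint.eval p) p

theorem matPart_momentJets {β : EuclideanSpace ℝ (Fin q)}
    (hint : Integrable (fun z => jets (scoreMoments m z) β) F) :
    matPart (momentJets m F β) (.inl ()) = secondMoment m F β :=
  Matrix.ext fun _ _ => momentJets_apply hint _

theorem vecPart_momentJets_deriv {β : EuclideanSpace ℝ (Fin q)}
    (hint : Integrable (fun z => jets (scoreMoments m z) β) F) (k : Fin q) :
    vecPart (momentJets m F β) (.inr (.inl k)) = fun a => scoreDeriv m F β a k :=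
  funext fun _ => momentJets_apply hint _

theorem vecPart_momentJets_eq_zero {β : EuclideanSpace ℝ (Fin q)}
    (hint : Integrable (fun z => jets (scoreMoments m z) β) F)
    (hzero : ∀ a, ∫ z, score m z β a ∂F = 0) :
    vecPart (momentJets m F β) (.inl ()) = 0 :=
  funext fun a => (momentJets_apply hint _).trans (hzero a)

theorem halfHess_momentJets {β : EuclideanSpace ℝ (Fin q)}
    (hint : Integrable (fun z => jets (scoreMoments m z) β) F)
    (hzero : ∀ a, ∫ z, score m z β a ∂F = 0) :
    Matrix.of (halfHess (momentJets m F β)) = infoMatrix m F β := by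
  have hsymm : ((secondMoment m F β)⁻¹)ᵀ = (secondMoment m F β)⁻¹ := by
    rw [Matrix.transpose_nonsing_inv]
    congr 1
    ext a b
    simp [secondMoment, mul_comm]
  ext j k
  rw [Matrix.of_apply, halfHess_of_vecPart_eq_zero (vecPart_momentJets_eq_zero hint hzero),
    vecPart_momentJets_deriv hint, vecPart_momentJets_deriv hint, matPart_momentJets hint,
    infoMatrix, Matrix.dotProduct_mulVec, ← Matrix.mulVec_transpose, hsymm, dotProduct_comm,
    Matrix.mul_assoc]
  rfl

/-- The scaled gradient of the quadratic inference function is a random matrix applied to the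
normalised sum of the scores. -/
theorem smul_grad_qif {N : ℕ} {z : ℕ → Obs n q} {β : EuclideanSpace ℝ (Fin q)}
    (hz : ∀ i, ContDiffAt ℝ 2 (score m (z i)) β) :
    (2 * √(N : ℝ))⁻¹ • grad (qif m N z) β =
      WithLp.toLp 2 (Matrix.of (halfGradCoeff (jets (meanMoments m N z) β)) *ᵥ
        ((√(N : ℝ))⁻¹ • ∑ i ∈ Finset.range N,
          (WithLp.toLp 2 (score m (z i) β) : EuclideanSpace ℝ (Fin s × Fin q))).ofLp) := by
  ext k
  -- For `N = 0` both sides are `0` under the convention for inverses.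
  have hN : (2 * √(N : ℝ))⁻¹ * (2 * N * (N : ℝ)⁻¹) = (√(N : ℝ))⁻¹ := by
    rcases N.eq_zero_or_pos with rfl | hN
    · simp
    · have : (N : ℝ) ≠ 0 := by positivity
      rw [mul_assoc, mul_inv_cancel₀ this, mul_one, mul_inv, mul_right_comm,
        inv_mul_cancel₀ two_ne_zero, one_mul]
  have hsum : ((√(N : ℝ))⁻¹ • ∑ i ∈ Finset.range N,
      (WithLp.toLp 2 (score m (z i) β) : EuclideanSpace ℝ (Fin s × Fin q))).ofLp =
      (√(N : ℝ))⁻¹ • ∑ i ∈ Finset.range N, score m (z i) β := by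
    ext a
    simp [Finset.sum_apply]
  rw [hsum, PiLp.smul_apply, grad, PiLp.toLp_apply, PiLp.toLp_apply, pderiv_qif m hz, scoreMean,
    Matrix.mulVec_smul, dotProduct_smul, smul_eq_mul, smul_eq_mul, Pi.smul_apply, smul_eq_mul,
    ← hN]
  simp only [Matrix.mulVec, Matrix.of_apply]
  ring

theorem tendstoInDistribution_grad_qif [IsProbabilityMeasure F] [IsProbabilityMeasure P]
    (hh : Measurable m.h) (hv : Measurable m.v)
    (hlaw : ∀ i, HasLaw (Z i) F P) (hindep : iIndepFun Z P)
    (hsmooth : ∀ᵐ z ∂F, ∀ β ∈ B, ContDiffAt ℝ 2 (score m z) β)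
    (hdom : ∀ a, DominatedUpToOrderTwo F B fun z β => score m z β a)
    (hdom₂ : ∀ a b, DominatedUpToOrderTwo F B fun z β => score m z β a * score m z β b)
    {β : EuclideanSpace ℝ (Fin q)} (hβ : β ∈ B) (hzero : ∀ a, ∫ z, score m z β a ∂F = 0)
    (hpos : (secondMoment m F β).PosDef) :
    TendstoInDistribution
      (fun (N : ℕ) ω => (2 * √(N : ℝ))⁻¹ • grad (qif m N fun i => Z i ω) β)
      atTop id (fun _ => P) (multivariateGaussian 0 (infoMatrix m F β)) := by
  have hint := integrable_jets hh hv hsmooth hdom hdom₂ hβ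
  have hdet : (matPart (momentJets m F β) (.inl ())).det ≠ 0 := by
    rw [matPart_momentJets hint]
    exact hpos.det_pos.ne'
  have hclt := tendstoInDistribution_inv_sqrt_smul_sum hlaw hindep
    (f := fun z => (WithLp.toLp 2 (score m z β) : EuclideanSpace ℝ (Fin s × Fin q)))
    (fun a => (memLp_two_iff_integrable_sq
      (measurable_score hh hv β a).aestronglyMeasurable).2 <| by
        -- Square integrability of a score component is integrability of the diagonal entry of `g
        -- gᵀ`.
        simpa [sq, jets, jet, scoreMoments] using hint.eval (.inr (a, a), .inl ())) hzero
  obtain ⟨-, D, -, hD0, hD⟩ := uniform_law_jets hh hv hlaw hindep hsmooth hdom hdom₂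
    (Set.singleton_subset_iff.2 hβ) isCompact_singleton
  have hlim : ∀ᵐ ω ∂P, Tendsto (fun N : ℕ => jets (meanMoments m N fun i => Z i ω) β) atTop
      (𝓝 (momentJets m F β)) := by
    filter_upwards [hD0, hD] with ω h0 h
    exact tendsto_iff_dist_tendsto_zero.2
      (squeeze_zero (fun _ => dist_nonneg) (fun N => h N β rfl) h0)
  have hjm : ∀ N : ℕ, AEMeasurable (fun ω => jets (meanMoments m N fun i => Z i ω) β) P := by
    intro N
    have h1 : AEMeasurable
        (fun ω => (N : ℝ)⁻¹ • ∑ i ∈ Finset.range N, jets (scoreMoments m (Z i ω)) β) P :=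
      (measurable_const_smul _).comp_aemeasurable (Finset.aemeasurable_fun_sum _ fun i _ =>
        (identDistrib_comp_of_hasLaw hlaw (aemeasurable_jets hh hv hsmooth hβ) i
          i).aemeasurable_fst)
    refine h1.congr ?_
    filter_upwards [ae_forall_of_hasLaw hlaw hsmooth] with ω hs
    exact (jets_meanMoments m N fun i => hs i β hβ).symm
  have hcoeff_meas : ∀ N : ℕ, AEMeasurable
      (fun ω => halfGradCoeff (jets (meanMoments m N fun i => Z i ω) β)) P := fun N =>
    (measurable_pi_iff.2 fun k => measurable_pi_iff.2 fun b =>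
      measurable_halfGradCoeff k b).comp_aemeasurable (hjm N)
  have hcoeff : TendstoInMeasure P
      (fun (N : ℕ) ω => halfGradCoeff (jets (meanMoments m N fun i => Z i ω) β)) atTop
      fun _ => halfGradCoeff (momentJets m F β) := by
    refine tendstoInMeasure_of_tendsto_ae (fun N => (hcoeff_meas N).aestronglyMeasurable) ?_
    filter_upwards [hlim] with ω hω
    exact tendsto_pi_nhds.2 fun k => (continuousAt_halfGradCoeff hdet k).tendsto.comp hω
  have hg : Continuous fun p : EuclideanSpace ℝ (Fin s × Fin q) × (Fin q → Fin s × Fin q → ℝ) =>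
      (WithLp.toLp 2 (Matrix.of p.2 *ᵥ p.1.ofLp) : EuclideanSpace ℝ (Fin q)) := by
    refine (PiLp.continuous_toLp 2 _).comp (Continuous.matrix_mulVec ?_
      ((PiLp.continuous_ofLp 2 _).comp continuous_fst))
    exact continuous_snd
  -- Slutsky: the random coefficient matrix has a constant limit in probability, and the normalised
  -- score sum a Gaussian one.
  have hslutsky := hclt.continuous_comp_prodMk_of_tendstoInMeasure_const hg hcoeff hcoeff_meas
  refine (TendstoInDistribution.of_map_eq hslutsky ?_).congr (fun N => ?_) (ae_eq_refl _)
  · refine (map_mulVec_multivariateGaussian (Matrix.of (halfGradCoeff (momentJets m F β)))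
      hpos.posSemidef).trans ?_
    have hC : (Matrix.of (halfGradCoeff (momentJets m F β)) : Matrix (Fin q) (Fin s × Fin q) ℝ) =
        (scoreDeriv m F β)ᵀ * (secondMoment m F β)⁻¹ := by
      ext k b
      rw [Matrix.of_apply,
        halfGradCoeff_of_vecPart_eq_zero (vecPart_momentJets_eq_zero hint hzero),
        vecPart_momentJets_deriv hint, matPart_momentJets hint]
      rfl
    have hsymm : (secondMoment m F β)ᵀ = secondMoment m F β := by
      ext a b
      simp [secondMoment, mul_comm]
    -- With `C = Dᵀ Σ⁻¹` the limiting covariance `C Σ Cᵀ` collapses to `Dᵀ Σ⁻¹ D`.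
    rw [hC, infoMatrix, Matrix.transpose_mul, Matrix.transpose_transpose,
      Matrix.transpose_nonsing_inv, hsymm, Matrix.nonsing_inv_mul_cancel_right _ _
        (isUnit_iff_ne_zero.2 hpos.det_pos.ne'), ← Matrix.mul_assoc]
  · filter_upwards [ae_forall_of_hasLaw hlaw hsmooth] with ω hs
    exact (smul_grad_qif fun i => hs i β hβ).symm

/-- Up to a null set the bad event lies in `{δ ≤ |D N|}`, whose probability tends to `0`; the bad
event itself need not be measurable. Closeness of the jets also makes the empirical matrix
invertible on all of `K`, so the Hessian formula applies there. -/
theorem tendsto_measure_hess_qif [IsProbabilityMeasure F] [IsProbabilityMeasure P]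
    (hh : Measurable m.h) (hv : Measurable m.v)
    (hlaw : ∀ i, HasLaw (Z i) F P) (hindep : iIndepFun Z P)
    (hsmooth : ∀ᵐ z ∂F, ∀ β ∈ B, ContDiffAt ℝ 2 (score m z) β)
    (hdom : ∀ a, DominatedUpToOrderTwo F B fun z β => score m z β a)
    (hdom₂ : ∀ a b, DominatedUpToOrderTwo F B fun z β => score m z β a * score m z β b)
    (hpos : ∀ β ∈ B, (secondMoment m F β).PosDef)
    {K : Set (EuclideanSpace ℝ (Fin q))} (hKB : K ⊆ B) (hK : IsCompact K) {ε : ℝ} (hε : 0 < ε) :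
    Tendsto (fun N : ℕ => P {ω | ∃ β ∈ K, ∃ j k,
        ε ≤ |(2 * (N : ℝ))⁻¹ * hess (qif m N fun i => Z i ω) β j k -
          halfHess (momentJets m F β) j k|})
      atTop (𝓝 0) := by
  obtain ⟨hc, D, hDm, hD0, hD⟩ := uniform_law_jets hh hv hlaw hindep hsmooth hdom hdom₂ hKB hK
  obtain ⟨δ, hδ, hclose⟩ := exists_forall_dist_lt_halfHess (hK.image_of_continuousOn hc)
    (by
      rintro _ ⟨β, hβ, rfl⟩
      rw [matPart_momentJets (integrable_jets hh hv hsmooth hdom hdom₂ (hKB hβ))]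
      exact (hpos β (hKB hβ)).det_pos.ne') hε
  have hmeas := tendstoInMeasure_iff_norm.1
    (tendstoInMeasure_of_tendsto_ae (fun N => (hDm N).aestronglyMeasurable) hD0) δ hδ
  refine tendsto_of_tendsto_of_tendsto_of_le_of_le' tendsto_const_nhds hmeas
    (Eventually.of_forall fun _ => zero_le) ?_
  -- Positivity of `N` is needed to cancel the factor `2 * N`.
  filter_upwards [eventually_gt_atTop 0] with N hN
  refine measure_mono_ae ?_
  filter_upwards [hD, ae_forall_of_hasLaw hlaw hsmooth] with ω hω hs
  rintro ⟨β, hβ, j, k, hjk⟩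
  by_contra hlt
  have hlt' : D N ω < δ := by
    refine (le_abs_self _).trans_lt ?_
    simpa using not_le.1 hlt
  obtain ⟨hdet, hh'⟩ := hclose _ (Set.mem_image_of_mem _ hβ) _ ((hω N β hβ).trans_lt hlt')
  rw [matPart_jets_meanMoments] at hdet
  rw [hess_qif m (fun i => hs i β (hKB hβ)) hdet, inv_mul_cancel_left₀ (by positivity)] at hjk
  exact (hh' j k).not_ge hjk

end Asymptotics

end QIF

/-! ### The main theorem. -/

theorem theorem3p1 {n q s : ℕ} (m : QIF.Model n s)
    (hφ : 0 < m.φ) (hh : Measurable m.h) (hv : Measurable m.v)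
    -- the parameter set and the true parameter
    (B : Set (EuclideanSpace ℝ (Fin q))) (β₀ : EuclideanSpace ℝ (Fin q)) (hβ₀ : β₀ ∈ B)
    -- the subjects are an independent sample from `F`
    (F : Measure (QIF.Obs n q)) [IsProbabilityMeasure F]
    {Ω : Type*} [MeasurableSpace Ω] (P : Measure Ω) [IsProbabilityMeasure P]
    (Z : ℕ → Ω → QIF.Obs n q) (hlaw : ∀ i, HasLaw (Z i) F P) (hindep : iIndepFun Z P)
    -- the mean model, given the covariates
    (hint : ∀ t, Integrable (fun z : QIF.Obs n q => z.1 t) F)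
    (hmean : ∀ t, F[fun z : QIF.Obs n q => z.1 t | MeasurableSpace.comap Prod.snd inferInstance]
      =ᵐ[F] fun z => m.h (inner ℝ (z.2 t) β₀))
    -- the score is well defined near `B` and twice continuously differentiable there
    (hwell : ∀ᵐ z ∂F, ∀ᶠ β in 𝓝ˢ B, ∀ t,
      DifferentiableAt ℝ m.h (inner ℝ (z.2 t) β) ∧ 0 < m.v (inner ℝ (z.2 t) β))
    (hsmooth : ∀ᵐ z ∂F, ∀ β ∈ B, ContDiffAt ℝ 2 (QIF.score m z) β)
    -- finite means of the score, of the second moments, and of their derivatives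
    (hdom : ∀ a, QIF.DominatedUpToOrderTwo F B fun z β => QIF.score m z β a)
    (hdom₂ : ∀ a b, QIF.DominatedUpToOrderTwo F B
      fun z β => QIF.score m z β a * QIF.score m z β b)
    -- nondegeneracy of the second moment matrix
    (hpos : ∀ β ∈ B, (QIF.secondMoment m F β).PosDef) :
    TendstoInDistribution
        (fun (N : ℕ) ω => (2 * √(N : ℝ))⁻¹ • QIF.grad (QIF.qif m N fun i => Z i ω) β₀)
        atTop id (fun _ => P) (multivariateGaussian 0 (QIF.infoMatrix m F β₀)) ∧
      ∃ V : EuclideanSpace ℝ (Fin q) → Matrix (Fin q) (Fin q) ℝ,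
        ContinuousOn V B ∧ V β₀ = QIF.infoMatrix m F β₀ ∧
        ∀ K ⊆ B, IsCompact K → ∀ ε > 0,
          Tendsto (fun N : ℕ => P {ω | ∃ β ∈ K, ∃ j k,
              ε ≤ |(2 * (N : ℝ))⁻¹ * QIF.hess (QIF.qif m N fun i => Z i ω) β j k - V β j k|})
            atTop (𝓝 0) := by
  have hint' := QIF.integrable_jets hh hv hsmooth hdom hdom₂ hβ₀
  have hzero : ∀ a, ∫ z, QIF.score m z β₀ a ∂F = 0 := fun a =>
    QIF.integral_score_eq_zero hh hv hint hmean (hint'.eval (.inl a, .inl ()))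
  refine ⟨QIF.tendstoInDistribution_grad_qif hh hv hlaw hindep hsmooth hdom hdom₂ hβ₀ hzero
    (hpos β₀ hβ₀), fun β => Matrix.of (QIF.halfHess (QIF.momentJets m F β)), ?_,
    QIF.halfHess_momentJets hint' hzero, fun K hKB hK ε hε =>
      QIF.tendsto_measure_hess_qif hh hv hlaw hindep hsmooth hdom hdom₂ hpos hKB hK hε⟩
  intro β hβ
  have hdet : (QIF.matPart (QIF.momentJets m F β) (.inl ())).det ≠ 0 := by
    rw [QIF.matPart_momentJets (QIF.integrable_jets hh hv hsmooth hdom hdom₂ hβ)]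
    exact (hpos β hβ).det_pos.ne'
  have hcont := QIF.continuousOn_momentJets hh hv hlaw hindep hsmooth hdom hdom₂ β hβ
  exact tendsto_pi_nhds.2 fun j => tendsto_pi_nhds.2 fun k =>
    (QIF.continuousAt_halfHess hdet j k).tendsto.comp hcont
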